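/- Let $\mathcal M$ be a crossed square of groups $$\begin{array}{ccc} L & \xrightarrow{\ \lambda\ } & M\\ {\scriptstyle\lambda'}\downarrow & & \downarrow{\scriptstyle\mu}\\ N & \xrightarrow{\ \nu\ } & P\end{array}$$ with actions of $P$ on $L,M,N$ and $h$-map $h:M\times N\to L$. Let $X(\mathcal M)$ be its binerve, i.e. the bisimplicial group obtained by taking the nerve in both directions of the associated cat$^2$-group $(L\rtimes N)\rtimes(M\rtimes P)$, so that $X_{p,q}\cong(L^{(q)}\rtimes N)^{(p)}\rtimes(M^{(q)}\rtimes P)$ with $p$ the horizontal and $q$ the vertical index; the nerve of a crossed module $\mu: M\to P$ has $d_0(m,p)=\mu(m)p$, $d_1(m,p)=p$. Let $G=\nabla X(\mathcal M)$ be the Artin–Mazur codiagonal, where $G_n$ is the group of families $(x_0,\dots,x_n)$, $x_p\in X_{p,n-p}$, with $d_0^v x_p=d_{p+1}^h x_{p+1}$ for $0\le p<n$. Let $NG$ be its Moore complex, $NG_n=\bigcap_{i<n}\ker d_i$, with $\partial_n$ the restriction of $d_n$. Then $NG_n=1$ for $n\ge 3$, and $NG$ is isomorphic, as a normal chain complex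 of groups, to Loday's mapping cone $$\cdots\to 1\to L\xrightarrow{\ \partial_2\ }M\rtimes N\xrightarrow{\ \partial_1\ }P,\qquad \partial_2(l)=(\lambda(l)^{-1},\lambda'(l)),\quad \partial_1(m,n)=\mu(m)\nu(n),$$ where $N$ acts on $M$ via $\nu$. The isomorphism can be chosen so that $p\in P$ corresponds to $p\in NG_0=X_{0,0}=P$; so that $(m,n)\in M\rtimes N$ corresponds to the element $\big((m^{-1},\mu(m)\nu(n)),\,(n^{-1},\nu(n))\big)$ of $NG_1$; and so that $l\in L$ corresponds to the element $$\big((\lambda(l)^{-1},\lambda(l),1),\ ((l,\lambda'(l)^{-1}),(\lambda(l)^{-1},\mu\lambda(l))),\ (1,1,1)\big)$$ of $NG_2$, where a $2$-simplex of a nerve is written $(m_2,m_1,p)$ with $d_0(m_2,m_1,p)=(m_2,\mu(m_1)p)$, $d_1(m_2,m_1,p)=(m_2m_1,p)$, $d_2(m_2,m_1,p)=(m_1,p)$. Moreover, along this isomorphism the mapping cone carries the 2-crossed module structure of the Moore complex $NG$ of length $2$: there is a 2-crossed module with boundaries $\partial_2,\partial_1$ above whose $P$-actions on $L$ and $M\rtimes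 N$ and whose Peiffer lifting $(M\rtimes N)\times(M\rtimes N)\to L$ correspond, respectively, to the actions of $NG_0$ on $NG_2$ and $NG_1$ by conjugation through the degeneracies $s_1s_0$ and $s_0$, and to the pairing $\{x,y\}=s_0(x)\,s_1(y)\,s_0(x)^{-1}\,s_1(xy^{-1}x^{-1})$ from $NG_1\times NG_1$ to $NG_2$. -/

import Mathlib

open CategoryTheory Opposite

universe u

/-- A homomorphism `d : M → P` together with an action of `P` on `M` is a crossed module. -/
structure IsCrossedModule {M P : Type*} [Group M] [Group P]
    (act : P →* MulAut M) (d : M →* P) : Prop where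
  equivariant : ∀ p m, d (act p m) = p * d m * p⁻¹
  peiffer : ∀ m m', act (d m) m' = m * m' * m⁻¹

/-- The pair `(φ, ψ)` is a morphism of crossed modules from `d : M → P` to `d' : M' → P'`. -/
structure IsCrossedModuleHom {M P M' P' : Type*} [Group M] [Group P] [Group M'] [Group P']
    (act : P →* MulAut M) (d : M →* P) (act' : P' →* MulAut M') (d' : M' →* P')
    (φ : M →* M') (ψ : P →* P') : Prop where
  comm : ∀ m, d' (φ m) = ψ (d m)
  equivariant : ∀ p m, φ (act p m) = act' (ψ p) (φ m)

/-- A crossed square of groups, i.e. a commutative square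
```
  L --lam--> M
  |          |
 lam'        mu
  v          v
  N --nu---> P
```
with actions of `P` on `L`, `M`, `N` and a function `h : M × N → L`.  The groups `M` and `N` act
on the other groups via `mu` and `nu`. -/
structure CrossedSquare (L M N P : Type*) [Group L] [Group M] [Group N] [Group P] where
  lam : L →* M
  lam' : L →* N
  mu : M →* P
  nu : N →* P
  actL : P →* MulAut L
  actM : P →* MulAut M
  actN : P →* MulAut N
  h : M → N → L
  comm : mu.comp lam = nu.comp lam'
  crossed_lam : IsCrossedModule (actL.comp mu) lam
  crossed_lam' : IsCrossedModule (actL.comp nu) lam'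
  crossed_mu : IsCrossedModule actM mu
  crossed_nu : IsCrossedModule actN nu
  crossed_kappa : IsCrossedModule actL (mu.comp lam)
  hom_lam_kappa : IsCrossedModuleHom (actL.comp mu) lam actL (mu.comp lam) (MonoidHom.id L) mu
  hom_kappa_mu : IsCrossedModuleHom actL (mu.comp lam) actM mu lam (MonoidHom.id P)
  hom_lam'_kappa : IsCrossedModuleHom (actL.comp nu) lam' actL (mu.comp lam) (MonoidHom.id L) nu
  hom_kappa_nu : IsCrossedModuleHom actL (mu.comp lam) actN nu lam' (MonoidHom.id P)
  lam_h : ∀ m n, lam (h m n) = m * actM (nu n) m⁻¹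
  lam'_h : ∀ m n, lam' (h m n) = actN (mu m) n * n⁻¹
  h_lam : ∀ l n, h (lam l) n = l * actL (nu n) l⁻¹
  h_lam' : ∀ m l, h m (lam' l) = actL (mu m) l * l⁻¹
  h_mul_left : ∀ m m₁ n, h (m * m₁) n = actL (mu m) (h m₁ n) * h m n
  h_mul_right : ∀ m n n₁, h m (n * n₁) = h m n * actL (nu n) (h m n₁)
  h_equivariant : ∀ p m n, h (actM p m) (actN p n) = actL p (h m n)

/-- A 2-crossed module `L → M → N` with Peiffer lifting `lift : M × M → L`. The action of `M` on
`L` that is used in `lift_mul_right` is `(m, l) ↦ {d₂ l, m} l`. -/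
structure TwoCrossedModule (L M N : Type*) [Group L] [Group M] [Group N] where
  d₂ : L →* M
  d₁ : M →* N
  actL : N →* MulAut L
  actM : N →* MulAut M
  lift : M → M → L
  d₁_d₂ : ∀ l, d₁ (d₂ l) = 1
  d₂_equivariant : ∀ n l, d₂ (actL n l) = actM n (d₂ l)
  d₁_equivariant : ∀ n m, d₁ (actM n m) = n * d₁ m * n⁻¹
  d₂_lift : ∀ m m', d₂ (lift m m') = actM (d₁ m) m' * (m * m'⁻¹ * m⁻¹)
  lift_d₂_d₂ : ∀ l l', lift (d₂ l) (d₂ l') = l' * l * l'⁻¹ * l⁻¹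
  lift_mul_left : ∀ m m' m'',
    lift (m * m') m'' = actL (d₁ m) (lift m' m'') * lift m (m' * m'' * m'⁻¹)
  lift_mul_right : ∀ m m' m'',
    lift m (m' * m'') =
      lift m m' * (lift (d₂ (lift m m'')) (m * m' * m⁻¹) * lift m m'')
  lift_d₂_mul_lift_d₂ : ∀ m l, lift m (d₂ l) * lift (d₂ l) m = actL (d₁ m) l * l⁻¹
  lift_equivariant : ∀ n m m', actL n (lift m m') = lift (actM n m) (actM n m')

/-! ### Cat¹-groups and cat²-groups -/

/-- `(G, s, t)` is a cat¹-group. -/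
structure IsCat1Group {G : Type*} [Group G] (s t : G →* G) : Prop where
  s_t : ∀ g, s (t g) = t g
  t_s : ∀ g, t (s g) = s g
  ker_comm : ∀ g ∈ s.ker, ∀ g' ∈ t.ker, g * g' = g' * g

/-- A cat²-group with underlying group `G`. -/
structure Cat2Group (G : Type*) [Group G] where
  s₁ : G →* G
  t₁ : G →* G
  s₂ : G →* G
  t₂ : G →* G
  cat₁ : IsCat1Group s₁ t₁
  cat₂ : IsCat1Group s₂ t₂
  s₁_s₂ : ∀ g, s₁ (s₂ g) = s₂ (s₁ g)
  t₁_t₂ : ∀ g, t₁ (t₂ g) = t₂ (t₁ g)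
  s₁_t₂ : ∀ g, s₁ (t₂ g) = t₂ (s₁ g)
  s₂_t₁ : ∀ g, s₂ (t₁ g) = t₁ (s₂ g)

section

variable {M P : Type*} [Group M] [Group P] (act : P →* MulAut M) (d : M →* P)

/-- The endomorphism `(m, p) ↦ (1, p)` of `M ⋊ P`. -/
def catSource : M ⋊[act] P →* M ⋊[act] P :=
  SemidirectProduct.inr.comp SemidirectProduct.rightHom

variable {act d}

/-- The endomorphism `(m, p) ↦ (1, d(m) p)` of `M ⋊ P`. -/
def catTarget (hd : IsCrossedModule act d) : M ⋊[act] P →* M ⋊[act] P where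
  toFun x := ⟨1, d x.left * x.right⟩
  map_one' := by ext <;> simp
  map_mul' x y := by ext <;> simp [hd.equivariant, mul_assoc]

/-- The cat¹-group associated to a crossed module. -/
theorem isCat1Group_of_crossedModule (hd : IsCrossedModule act d) :
    IsCat1Group (catSource act) (catTarget hd) where
  s_t g := by ext <;> simp [catSource, catTarget]
  t_s g := by ext <;> simp [catSource, catTarget]
  ker_comm g hg g' hg' := by
    obtain ⟨m, p⟩ := g
    obtain ⟨m', p'⟩ := g'
    have h1 : p = 1 := congrArg SemidirectProduct.right (MonoidHom.mem_ker.1 hg)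
    have h2 : d m' * p' = 1 := by
      have := congrArg SemidirectProduct.right (MonoidHom.mem_ker.1 hg')
      simpa [catTarget] using this
    obtain rfl : p' = (d m')⁻¹ := eq_inv_of_mul_eq_one_right h2
    subst h1
    ext
    · simp only [SemidirectProduct.mul_left, map_one, MulAut.one_apply, ← map_inv, hd.peiffer]
      group
    · simp

end

namespace CrossedSquare

variable {L M N P : Type*} [Group L] [Group M] [Group N] [Group P] (C : CrossedSquare L M N P)

/-- The semidirect product `L ⋊ N`. -/
abbrev LN : Type _ := L ⋊[C.actL.comp C.nu] N

/-- The semidirect product `M ⋊ P`. -/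
abbrev MP : Type _ := M ⋊[C.actM] P

theorem lam_act (p : P) (l : L) : C.lam (C.actL p l) = C.actM p (C.lam l) :=
  C.hom_kappa_mu.equivariant p l

theorem lam'_act (p : P) (l : L) : C.lam' (C.actL p l) = C.actN p (C.lam' l) :=
  C.hom_kappa_nu.equivariant p l

theorem nu_lam' (l : L) : C.nu (C.lam' l) = C.mu (C.lam l) :=
  (DFunLike.congr_fun C.comm l).symm

theorem act_kappa (l l' : L) : C.actL (C.mu (C.lam l)) l' = l * l' * l⁻¹ :=
  C.crossed_kappa.peiffer l l'

theorem mu_act (p : P) (m : M) : C.mu (C.actM p m) = p * C.mu m * p⁻¹ :=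
  C.crossed_mu.equivariant p m

theorem nu_act (p : P) (n : N) : C.nu (C.actN p n) = p * C.nu n * p⁻¹ :=
  C.crossed_nu.equivariant p n

theorem h_one_left (n : N) : C.h 1 n = 1 := by
  have := C.h_lam 1 n
  simpa using this

theorem h_one_right (m : M) : C.h m 1 = 1 := by
  have := C.h_lam' m 1
  simpa using this

/-- The interchange of the actions of `M` and `N` on `L`. -/
theorem act_mu_nu (m : M) (n : N) (l : L) :
    C.actL (C.mu m) (C.actL (C.nu n) l) =
      C.h m n * C.actL (C.nu n) (C.actL (C.mu m) l) * (C.h m n)⁻¹ := by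
  rw [← C.act_kappa, C.lam_h]
  simp only [map_mul, map_inv, C.mu_act]
  simp only [← MulAut.mul_apply, ← map_mul, ← map_inv]
  congr 2
  simp [mul_assoc]

/-- The element `(m, p)` of `M ⋊ P` acts on `L ⋊ N` by
`(l, n) ↦ (ᵘl · h(m, ᵖn), ᵖn)` where `u = μ(m) p`. -/
def actLNEnd (x : C.MP) : C.LN →* C.LN where
  toFun y := ⟨C.actL (C.mu x.left * x.right) y.left * C.h x.left (C.actN x.right y.right),
    C.actN x.right y.right⟩
  map_one' := by
    ext <;> simp [h_one_right]
  map_mul' y z := by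
    obtain ⟨m, p⟩ := x
    obtain ⟨l, n⟩ := y
    obtain ⟨l', n'⟩ := z
    ext
    · have e : C.actL p (C.actL (C.nu n) l') = C.actL (C.nu (C.actN p n)) (C.actL p l') := by
        simp only [C.nu_act, ← MulAut.mul_apply, ← map_mul]
        simp
      simp only [SemidirectProduct.mk_eq_inl_mul_inr, SemidirectProduct.mul_left,
        SemidirectProduct.mul_right, SemidirectProduct.left_inl, SemidirectProduct.right_inl,
        SemidirectProduct.left_inr, SemidirectProduct.right_inr, map_one, map_mul,
        MulAut.mul_apply, MonoidHom.comp_apply, C.h_mul_right, e, C.act_mu_nu m, mul_one, one_mul,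
        MulAut.one_apply]
      group
    · simp

theorem actLNEnd_one : C.actLNEnd 1 = MonoidHom.id _ := by
  ext y <;> simp [actLNEnd, h_one_left]

theorem actLNEnd_mul (x x' : C.MP) :
    C.actLNEnd (x * x') = (C.actLNEnd x).comp (C.actLNEnd x') := by
  refine MonoidHom.ext fun y => ?_
  obtain ⟨m, p⟩ := x
  obtain ⟨m', p'⟩ := x'
  obtain ⟨l, n⟩ := y
  ext
  · simp only [actLNEnd, MonoidHom.coe_mk, OneHom.coe_mk, MonoidHom.comp_apply,
      SemidirectProduct.mk_eq_inl_mul_inr, SemidirectProduct.mul_left,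
      SemidirectProduct.mul_right, SemidirectProduct.left_inl, SemidirectProduct.right_inl,
      SemidirectProduct.left_inr, SemidirectProduct.right_inr, map_one, map_mul, map_inv,
      MulAut.mul_apply, mul_one, one_mul, MulAut.one_apply, C.mu_act, C.h_mul_left,
      ← C.h_equivariant, MulAut.inv_apply_self, h_one_right, mul_assoc, one_mul, mul_one]
  · simp [actLNEnd]

/-- The action of `M ⋊ P` on `L ⋊ N`. -/
def actLN : C.MP →* MulAut C.LN where
  toFun x := (C.actLNEnd x).toMulEquiv (C.actLNEnd x⁻¹)
    (by rw [← actLNEnd_mul, inv_mul_cancel, actLNEnd_one])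
    (by rw [← actLNEnd_mul, mul_inv_cancel, actLNEnd_one])
  map_one' := MulEquiv.ext fun y => by simp [actLNEnd_one]
  map_mul' x x' := MulEquiv.ext fun y => by simp [actLNEnd_mul]

theorem actLN_apply (x : C.MP) (y : C.LN) :
    C.actLN x y = ⟨C.actL (C.mu x.left * x.right) y.left * C.h x.left (C.actN x.right y.right),
      C.actN x.right y.right⟩ := rfl

/-- The homomorphism `(l, n) ↦ (lam(l), nu(n))` from `L ⋊ N` to `M ⋊ P`. -/
def bdLN : C.LN →* C.MP where
  toFun y := ⟨C.lam y.left, C.nu y.right⟩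
  map_one' := by ext <;> simp
  map_mul' y z := by ext <;> simp [lam_act]

theorem crossed_bdLN : IsCrossedModule C.actLN C.bdLN where
  equivariant x y := by
    obtain ⟨m, p⟩ := x
    obtain ⟨l, n⟩ := y
    rw [eq_mul_inv_iff_mul_eq, actLN_apply]
    ext
    · simp [bdLN, lam_act, lam_h, nu_act, C.crossed_mu.peiffer]
    · simp [bdLN, nu_act]
  peiffer y z := by
    obtain ⟨l, n⟩ := y
    obtain ⟨l', n'⟩ := z
    rw [eq_mul_inv_iff_mul_eq, actLN_apply]
    ext
    · simp [bdLN, act_kappa, h_lam, C.crossed_nu.peiffer, mul_assoc]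
    · simp [bdLN, C.crossed_nu.peiffer]

/-- The big group `(L ⋊ N) ⋊ (M ⋊ P)`. -/
abbrev Big : Type _ := C.LN ⋊[C.actLN] C.MP

/-- The endomorphism `((l, n), (m, p)) ↦ ((1, n), (1, p))`. -/
def vSource : C.Big →* C.Big where
  toFun g := ⟨⟨1, g.left.right⟩, ⟨1, g.right.right⟩⟩
  map_one' := by ext <;> simp
  map_mul' x y := by
    ext <;> simp [actLN_apply, h_one_left]

/-- The endomorphism `((l, n), (m, p)) ↦ ((1, lam'(l) n), (1, mu(m) p))`. -/
def vTarget : C.Big →* C.Big where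
  toFun g := ⟨⟨1, C.lam' g.left.left * g.left.right⟩, ⟨1, C.mu g.right.left * g.right.right⟩⟩
  map_one' := by ext <;> simp
  map_mul' x y := by
    ext
    · simp [actLN_apply, h_one_left]
    · simp [actLN_apply, h_one_left, lam'_act, lam'_h, mul_assoc, C.crossed_nu.peiffer]
    · simp
    · simp [mu_act, mul_assoc]

theorem isCat1Group_v : IsCat1Group C.vSource C.vTarget where
  s_t g := by ext <;> simp [vSource, vTarget]
  t_s g := by ext <;> simp [vSource, vTarget]
  ker_comm g hg g' hg' := by
    obtain ⟨⟨l, n⟩, ⟨m, p⟩⟩ := g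
    obtain ⟨⟨l', n'⟩, ⟨m', p'⟩⟩ := g'
    have hn : n = 1 := congrArg (fun z : C.Big => z.left.right) (MonoidHom.mem_ker.1 hg)
    have hp : p = 1 := congrArg (fun z : C.Big => z.right.right) (MonoidHom.mem_ker.1 hg)
    have hn' : C.lam' l' * n' = 1 :=
      congrArg (fun z : C.Big => z.left.right) (MonoidHom.mem_ker.1 hg')
    have hp' : C.mu m' * p' = 1 :=
      congrArg (fun z : C.Big => z.right.right) (MonoidHom.mem_ker.1 hg')
    obtain rfl : n' = C.lam' l'⁻¹ := by rw [map_inv]; exact eq_inv_of_mul_eq_one_right hn'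
    obtain rfl : p' = C.mu m'⁻¹ := by rw [map_inv]; exact eq_inv_of_mul_eq_one_right hp'
    subst hn hp
    ext
    · simp only [SemidirectProduct.mul_left, actLN_apply, map_one,
        mul_one, MulAut.one_apply, MonoidHom.comp_apply, h_lam', h_one_right, nu_lam', act_kappa,
        ← map_mul, mul_inv_cancel]
      simp [mul_assoc]
    · simp [actLN_apply, -map_inv]
    · simp only [SemidirectProduct.mul_left, SemidirectProduct.mul_right, map_one,
        MulAut.one_apply, C.crossed_mu.peiffer]
      group
    · simp

/-- The cat²-group associated to a crossed square. -/
def cat2 : Cat2Group C.Big where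
  s₁ := catSource C.actLN
  t₁ := catTarget C.crossed_bdLN
  s₂ := C.vSource
  t₂ := C.vTarget
  cat₁ := isCat1Group_of_crossedModule C.crossed_bdLN
  cat₂ := C.isCat1Group_v
  s₁_s₂ g := by ext <;> simp [catSource, vSource]
  t₁_t₂ g := by
    ext <;> simp [catTarget, vTarget, bdLN, nu_lam', mul_assoc, mu_act]
  s₁_t₂ g := by ext <;> simp [catSource, vTarget]
  s₂_t₁ g := by ext <;> simp [catTarget, vSource, bdLN]

end CrossedSquare

/-! ### Bisimplicial groups and the binerve -/

/-- The arrows `i ≤ j` of the ordinal `[n]`. -/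
abbrev Arr (n : SimplexCategory) : Type :=
  {a : Fin (n.len + 1) × Fin (n.len + 1) // a.1 ≤ a.2}

/-- The map on arrows induced by a map of ordinals. -/
def Arr.map {m n : SimplexCategory} (f : m ⟶ n) (a : Arr m) : Arr n :=
  ⟨(f.toOrderHom a.1.1, f.toOrderHom a.1.2), f.toOrderHom.monotone a.2⟩

/-- The group of `n`-simplices of the nerve of a cat¹-group `(G, s, t)`, i.e. of functors from
the ordinal `[n]` to the associated internal groupoid: its arrows are the elements of `G`, the
source and target of `g` are `s(g)` and `t(g)` (objects are identified with their identity arrows)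
and the composite of `g` and `g'` with `t(g) = s(g')` is `g' s(g')⁻¹ g`. -/
def nerveSubgroup {G : Type*} [Group G] {s t : G →* G} (hst : IsCat1Group s t)
    (n : SimplexCategory) : Subgroup (Arr n → G) where
  carrier := {x |
    (∀ i j (hij : i ≤ j), s (x ⟨(i, j), hij⟩) = x ⟨(i, i), le_rfl⟩) ∧
    (∀ i j (hij : i ≤ j), t (x ⟨(i, j), hij⟩) = x ⟨(j, j), le_rfl⟩) ∧
    ∀ i j k (hij : i ≤ j) (hjk : j ≤ k),
      x ⟨(i, k), hij.trans hjk⟩ =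
        x ⟨(j, k), hjk⟩ * (s (x ⟨(j, k), hjk⟩))⁻¹ * x ⟨(i, j), hij⟩}
  one_mem' := by simp
  mul_mem' := by
    rintro x y ⟨hx1, hx2, hx3⟩ ⟨hy1, hy2, hy3⟩
    refine ⟨fun i j hij => by simp [hx1 i j, hy1 i j], fun i j hij => by simp [hx2 i j, hy2 i j],
      fun i j k hij hjk => ?_⟩
    have key := hst.ker_comm (y ⟨(j, k), hjk⟩ * (s (y ⟨(j, k), hjk⟩))⁻¹)
      (by
        have e : s (s (y ⟨(j, k), hjk⟩)) = s (y ⟨(j, k), hjk⟩) := by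
          rw [← hst.t_s (y ⟨(j, k), hjk⟩), hst.s_t]
        simp [MonoidHom.mem_ker, e])
      ((s (x ⟨(j, k), hjk⟩))⁻¹ * x ⟨(i, j), hij⟩)
      (by simp [MonoidHom.mem_ker, hx1 j k, hx2 i j, hx2 j j])
    simp only [Pi.mul_apply, hx3 i j k hij hjk, hy3 i j k hij hjk, map_mul, mul_inv_rev]
    calc _ = x ⟨(j, k), hjk⟩ * (((s (x ⟨(j, k), hjk⟩))⁻¹ * x ⟨(i, j), hij⟩) *
          (y ⟨(j, k), hjk⟩ * (s (y ⟨(j, k), hjk⟩))⁻¹)) * y ⟨(i, j), hij⟩ := by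
            simp only [mul_assoc]
      _ = _ := by rw [← key]; simp only [mul_assoc]
  inv_mem' := by
    rintro x ⟨hx1, hx2, hx3⟩
    refine ⟨fun i j hij => by simp [hx1 i j], fun i j hij => by simp [hx2 i j],
      fun i j k hij hjk => ?_⟩
    have e : s (s (x ⟨(j, k), hjk⟩)) = s (x ⟨(j, k), hjk⟩) := by
      rw [← hst.t_s (x ⟨(j, k), hjk⟩), hst.s_t]
    have key := hst.ker_comm (x ⟨(j, k), hjk⟩ * (s (x ⟨(j, k), hjk⟩))⁻¹)
      (by simp [MonoidHom.mem_ker, e])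
      (x ⟨(i, j), hij⟩ * (s (x ⟨(j, k), hjk⟩))⁻¹)
      (by simp [MonoidHom.mem_ker, hx1 j k, hx2 i j, hx2 j j])
    simp only [Pi.inv_apply, hx3 i j k hij hjk, map_inv]
    rw [← inv_inj]
    simp only [mul_inv_rev, inv_inv]
    have := congrArg (· * s (x ⟨(j, k), hjk⟩)) key
    simpa [mul_assoc] using this

theorem comp_map_mem_nerveSubgroup {G : Type*} [Group G] {s t : G →* G} (hst : IsCat1Group s t)
    {m n : SimplexCategory} (f : m ⟶ n) {x : Arr n → G} (hx : x ∈ nerveSubgroup hst n) :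
    (fun a => x (Arr.map f a)) ∈ nerveSubgroup hst m :=
  ⟨fun _ _ _ => hx.1 _ _ _, fun _ _ _ => hx.2.1 _ _ _, fun _ _ _ hij hjk =>
    hx.2.2 _ _ _ (f.toOrderHom.monotone hij) (f.toOrderHom.monotone hjk)⟩

/-- Bisimplicial groups; the first index is the horizontal one. -/
abbrev BisimplicialGroup := (SimplexCategory × SimplexCategory)ᵒᵖ ⥤ GrpCat.{u}

namespace Cat2Group

variable {G : Type u} [Group G] (A : Cat2Group G)

/-- The group of `(p, q)`-simplices of the binerve, i.e. of families of elements of `G` that are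
`p`-simplices of the nerve of `(G, s₁, t₁)` and `q`-simplices of the nerve of `(G, s₂, t₂)`. -/
def binerveSubgroup (p q : SimplexCategory) : Subgroup (Arr p → Arr q → G) where
  carrier := {x | (∀ b, (fun a => x a b) ∈ nerveSubgroup A.cat₁ p) ∧
    ∀ a, (fun b => x a b) ∈ nerveSubgroup A.cat₂ q}
  one_mem' := ⟨fun _ => one_mem _, fun _ => one_mem _⟩
  mul_mem' hx hy := ⟨fun b => mul_mem (hx.1 b) (hy.1 b), fun a => mul_mem (hx.2 a) (hy.2 a)⟩
  inv_mem' hx := ⟨fun b => inv_mem (hx.1 b), fun a => inv_mem (hx.2 a)⟩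

/-- The binerve of a cat²-group: its nerve in the two directions, as a bisimplicial group. -/
def binerve : BisimplicialGroup.{u} where
  obj pq := GrpCat.of (A.binerveSubgroup pq.unop.1 pq.unop.2)
  map f := GrpCat.ofHom
    { toFun := fun x => ⟨fun a b => x.1 (Arr.map f.unop.1 a) (Arr.map f.unop.2 b),
        fun b => comp_map_mem_nerveSubgroup A.cat₁ f.unop.1 (x.2.1 (Arr.map f.unop.2 b)),
        fun a => comp_map_mem_nerveSubgroup A.cat₂ f.unop.2 (x.2.2 (Arr.map f.unop.1 a))⟩
      map_one' := rfl
      map_mul' := fun _ _ => rfl }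
  map_id _ := rfl
  map_comp _ _ := rfl

end Cat2Group

/-! ### The codiagonal -/

section

open scoped Simplicial

namespace BisimplicialGroup

variable (X : BisimplicialGroup.{u})

/-- The group `X_{p,q}`. -/
abbrev at' (p q : ℕ) : GrpCat.{u} := X.obj (op (⦋p⦌, ⦋q⦌))

/-- The operator of `X` induced by a pair of maps of ordinals. -/
def pull {p q p' q' : ℕ} (f : ⦋p⦌ ⟶ ⦋p'⦌) (g : ⦋q⦌ ⟶ ⦋q'⦌) : X.at' p' q' →* X.at' p q :=
  (X.map (Quiver.Hom.op (Prod.mkHom f g))).hom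

/-- The horizontal face `d_i^h`. -/
def dH {p q : ℕ} (i : Fin (p + 2)) : X.at' (p + 1) q →* X.at' p q :=
  X.pull (SimplexCategory.δ i) (𝟙 _)

/-- The vertical face `d_j^v`. -/
def dV {p q : ℕ} (j : Fin (q + 2)) : X.at' p (q + 1) →* X.at' p q :=
  X.pull (𝟙 _) (SimplexCategory.δ j)

theorem pull_id {p q : ℕ} (x : X.at' p q) : X.pull (𝟙 _) (𝟙 _) x = x := by
  have : Quiver.Hom.op (Prod.mkHom (𝟙 ⦋p⦌) (𝟙 ⦋q⦌)) = 𝟙 (op (⦋p⦌, ⦋q⦌)) := rfl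
  simp [pull, this]

theorem pull_pull {p q p' q' p'' q'' : ℕ} (f : ⦋p⦌ ⟶ ⦋p'⦌) (g : ⦋q⦌ ⟶ ⦋q'⦌)
    (f' : ⦋p'⦌ ⟶ ⦋p''⦌) (g' : ⦋q'⦌ ⟶ ⦋q''⦌) (x : X.at' p'' q'') :
    X.pull f g (X.pull f' g' x) = X.pull (f ≫ f') (g ≫ g') x := by
  have : Quiver.Hom.op (Prod.mkHom (f ≫ f') (g ≫ g')) =
    Quiver.Hom.op (Prod.mkHom f' g') ≫ Quiver.Hom.op (Prod.mkHom f g) := rfl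
  simp [pull, this]

end BisimplicialGroup

/-- Pairs `(p, q)` with `p + q = n`. -/
abbrev Anti (n : ℕ) : Type := {a : ℕ × ℕ // a.1 + a.2 = n}

namespace Anti

variable {m n : SimplexCategory} (f : m ⟶ n)

theorem le (a : Anti m.len) : a.1.1 < m.len + 1 := by have := a.2; omega

/-- The pair `(f(p), n - f(p))` for a map `f : [m] → [n]` of ordinals and `p + q = m`. -/
def target (a : Anti m.len) : Anti n.len :=
  ⟨((f.toOrderHom ⟨a.1.1, a.le⟩ : ℕ), n.len - (f.toOrderHom ⟨a.1.1, a.le⟩ : ℕ)), by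
    have := (f.toOrderHom ⟨a.1.1, a.le⟩).2; dsimp only; omega⟩

/-- The restriction of `f` to a map from the initial segment `{0, …, p}` to `{0, …, f(p)}`. -/
def lower (a : Anti m.len) : ⦋a.1.1⦌ ⟶ ⦋(target f a).1.1⦌ :=
  SimplexCategory.Hom.mk
    { toFun := fun i => ⟨(f.toOrderHom ⟨i.1, by have := i.2; have := a.le; dsimp at *; omega⟩ : ℕ),
        Nat.lt_succ_of_le (Fin.le_def.1 (f.toOrderHom.monotone
          (Fin.mk_le_mk.2 (Nat.le_of_lt_succ i.2))))⟩
      monotone' := fun i j hij => Fin.mk_le_mk.2 (Fin.le_def.1 (f.toOrderHom.monotone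
          (Fin.mk_le_mk.2 (Fin.le_def.1 hij)))) }

/-- The restriction of `f` to a map from the final segment `{p, …, m}` to `{f(p), …, n}`, both
renumbered so as to start at `0`. -/
def upper (a : Anti m.len) : ⦋a.1.2⦌ ⟶ ⦋(target f a).1.2⦌ :=
  SimplexCategory.Hom.mk
    { toFun := fun i =>
        ⟨(f.toOrderHom ⟨a.1.1 + i.1, by have := i.2; have := a.2; dsimp at *; omega⟩ : ℕ) -
          (f.toOrderHom ⟨a.1.1, a.le⟩ : ℕ), by
          have := (f.toOrderHom ⟨a.1.1 + i.1, by
            have := i.2; have := a.2; dsimp at *; omega⟩).2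
          dsimp [target] at *
          omega⟩
      monotone' := fun i j hij => Fin.mk_le_mk.2 (Nat.sub_le_sub_right
        (Fin.le_def.1 (f.toOrderHom.monotone (Fin.mk_le_mk.2
          (Nat.add_le_add_left (Fin.le_def.1 hij) _)))) _) }

end Anti

namespace BisimplicialGroup

variable (X : BisimplicialGroup.{u})

/-- The group of `n`-simplices of the codiagonal of `X`: the families `(x_{p,q})_{p+q=n}` with
`d_0^v x_{p,q+1} = d_{p+1}^h x_{p+1,q}`. -/
def codiagSubgroup (n : ℕ) : Subgroup (∀ a : Anti n, X.at' a.1.1 a.1.2) where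
  carrier := {x | ∀ (p q : ℕ) (h : p + q + 1 = n),
    X.dV 0 (x ⟨(p, q + 1), h⟩) = X.dH (Fin.last (p + 1)) (x ⟨(p + 1, q), by dsimp; omega⟩)}
  one_mem' := fun p q h => by simp
  mul_mem' := fun {x y} hx hy p q h => by simp [hx p q h, hy p q h]
  inv_mem' := fun {x} hx p q h => by simp [hx p q h]

/-- Iterated form of the defining condition of the codiagonal. -/
theorem codiag_cond {n : ℕ} (x : X.codiagSubgroup n) (p q p' q' k : ℕ) (h : p + q = n)
    (h' : p' + q' = n) (hk : p' = p + k) (f : ⦋p⦌ ⟶ ⦋p'⦌) (hf : ∀ i, (f.toOrderHom i : ℕ) = i)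
    (g : ⦋q'⦌ ⟶ ⦋q⦌) (hg : ∀ i, (g.toOrderHom i : ℕ) = i + k) :
    X.pull (𝟙 _) g (x.1 ⟨(p, q), h⟩) = X.pull f (𝟙 _) (x.1 ⟨(p', q'), h'⟩) := by
  induction k generalizing p q with
  | zero =>
    obtain rfl : p' = p := hk
    obtain rfl : q' = q := by omega
    obtain rfl : f = 𝟙 _ := by ext i; exact hf i
    obtain rfl : g = 𝟙 _ := by ext i; exact hg i
    rfl
  | succ k ih =>
    obtain ⟨q, rfl⟩ : ∃ r, q = r + 1 := ⟨q - 1, by omega⟩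
    let f' : ⦋p + 1⦌ ⟶ ⦋p'⦌ := SimplexCategory.Hom.mk
      { toFun := fun i => ⟨i, by have := i.2; dsimp at *; omega⟩
        monotone' := fun i j hij => hij }
    let g' : ⦋q'⦌ ⟶ ⦋q⦌ := SimplexCategory.Hom.mk
      { toFun := fun i => ⟨i + k, by have := i.2; dsimp at *; omega⟩
        monotone' := fun i j hij => Fin.mk_le_mk.2 (Nat.add_le_add_right (Fin.le_def.1 hij) _) }
    have hff : f = SimplexCategory.δ (Fin.last (p + 1)) ≫ f' := by
      ext i
      rw [hf]
      simp [f', SimplexCategory.δ]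
      rfl
    have hgg : g = g' ≫ SimplexCategory.δ 0 := by
      ext i
      rw [hg]
      simp [g', SimplexCategory.δ]
      change (i : ℕ) + (k + 1) = (i : ℕ) + k + 1
      omega
    have e1 := ih (p + 1) q (by omega) (by omega) f' (fun i => rfl) g' (fun i => rfl)
    have e2 := x.2 p q (by omega)
    have e3 : X.pull (𝟙 _) g (x.1 ⟨(p, q + 1), h⟩) =
        X.pull (𝟙 _) g' (X.dV 0 (x.1 ⟨(p, q + 1), h⟩)) := by
      rw [dV, pull_pull, hgg]; rfl
    have e4 : X.pull f (𝟙 _) (x.1 ⟨(p', q'), h'⟩) =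
        X.pull (SimplexCategory.δ (Fin.last (p + 1))) (𝟙 _)
          (X.pull f' (𝟙 _) (x.1 ⟨(p', q'), h'⟩)) := by
      rw [pull_pull, hff]; rfl
    rw [e3, e2, e4, ← e1, dH, pull_pull, pull_pull]
    rfl

/-- The operator of the codiagonal induced by `f : [m] → [n]`. Its component at `p + q = m` is
the operator of `X` induced by the two restrictions `{0, …, p} → {0, …, f(p)}` and
`{p, …, m} → {f(p), …, n}` of `f`, applied to the component at `(f(p), n - f(p))`.
For the face and degeneracy maps this says
`d_j x = (d_j^v x_0, d_{j-1}^v x_1, …, d_1^v x_{j-1}, d_j^h x_{j+1}, …, d_j^h x_n)` and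
`s_i x = (s_i^v x_0, s_{i-1}^v x_1, …, s_0^v x_i, s_i^h x_i, …, s_i^h x_n)`,
where `x_p` is the component at `(p, n - p)`. -/
def codiagMap {m n : SimplexCategory} (f : m ⟶ n) :
    X.codiagSubgroup n.len →* X.codiagSubgroup m.len where
  toFun x := ⟨fun a => X.pull (Anti.lower f a) (Anti.upper f a) (x.1 (Anti.target f a)), by
    intro p q h
    have hm : (f.toOrderHom ⟨p, by omega⟩ : ℕ) ≤ f.toOrderHom ⟨p + 1, by omega⟩ :=
      Fin.le_def.1 (f.toOrderHom.monotone (Fin.mk_le_mk.2 (Nat.le_succ p)))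
    have hn := (f.toOrderHom ⟨p + 1, by omega⟩).2
    let a : Anti m.len := ⟨(p, q + 1), h⟩
    let b : Anti m.len := ⟨(p + 1, q), by dsimp only; omega⟩
    let F : ⦋(Anti.target f a).1.1⦌ ⟶ ⦋(Anti.target f b).1.1⦌ := SimplexCategory.Hom.mk
      { toFun := fun i => ⟨i, by have := i.2; dsimp [Anti.target, a, b] at *; omega⟩
        monotone' := fun i j hij => hij }
    let g : ⦋(Anti.target f b).1.2⦌ ⟶ ⦋(Anti.target f a).1.2⦌ := SimplexCategory.Hom.mk
      { toFun := fun i => ⟨i + ((f.toOrderHom ⟨p + 1, by omega⟩ : ℕ) -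
            (f.toOrderHom ⟨p, by omega⟩ : ℕ)), by
          have := i.2; dsimp [Anti.target, a, b] at *; omega⟩
        monotone' := fun i j hij => Fin.mk_le_mk.2 (Nat.add_le_add_right (Fin.le_def.1 hij) _) }
    have key := X.codiag_cond x _ _ _ _ _ (Anti.target f a).2 (Anti.target f b).2
      (by dsimp [Anti.target, a, b]; omega) F (fun i => rfl) g (fun i => rfl)
    have e1 : SimplexCategory.δ (Fin.last (p + 1)) ≫ Anti.lower f b = Anti.lower f a ≫ F := by
      ext i
      simp [SimplexCategory.δ]
      rfl
    have e2 : SimplexCategory.δ 0 ≫ Anti.upper f a = Anti.upper f b ≫ g := by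
      ext i
      have hi : p + 1 + (i : ℕ) < m.len + 1 := by have := i.2; dsimp at this; omega
      have hle : (f.toOrderHom ⟨p + 1, by omega⟩ : ℕ) ≤ f.toOrderHom ⟨p + 1 + i, hi⟩ :=
        Fin.le_def.1 (f.toOrderHom.monotone (Fin.mk_le_mk.2 (Nat.le_add_right _ _)))
      have h3 : p + ((i : ℕ) + 1) = p + 1 + i := by omega
      change (f.toOrderHom ⟨p + ((SimplexCategory.δ (n := q) 0).toOrderHom i : ℕ), _⟩ : ℕ) -
        (f.toOrderHom ⟨p, _⟩ : ℕ) = (f.toOrderHom ⟨p + 1 + i, _⟩ : ℕ) -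
        (f.toOrderHom ⟨p + 1, _⟩ : ℕ) +
        ((f.toOrderHom ⟨p + 1, _⟩ : ℕ) - (f.toOrderHom ⟨p, _⟩ : ℕ))
      have h4 : ((SimplexCategory.δ (n := q) 0).toOrderHom i : ℕ) = i + 1 := by
        simp [SimplexCategory.δ]
      simp only [h4, h3]
      omega
    calc X.dV 0 (X.pull (Anti.lower f a) (Anti.upper f a) (x.1 (Anti.target f a)))
        = X.pull (Anti.lower f a) (Anti.upper f b) (X.pull (𝟙 _) g (x.1 (Anti.target f a))) := by
          rw [dV, pull_pull, pull_pull, e2]; rfl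
      _ = X.pull (Anti.lower f a) (Anti.upper f b) (X.pull F (𝟙 _) (x.1 (Anti.target f b))) :=
          congrArg _ key
      _ = X.dH (Fin.last (p + 1))
          (X.pull (Anti.lower f b) (Anti.upper f b) (x.1 (Anti.target f b))) := by
          rw [dH, pull_pull, pull_pull, e1]; rfl⟩
  map_one' := by ext; simp
  map_mul' x y := by ext; simp

theorem codiagMap_id (n : SimplexCategory) (x : X.codiagSubgroup n.len) :
    X.codiagMap (𝟙 n) x = x := by
  have key : ∀ (a b : Anti n.len) (_ : a = b) (u : ⦋a.1.1⦌ ⟶ ⦋b.1.1⦌) (v : ⦋a.1.2⦌ ⟶ ⦋b.1.2⦌)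
      (_ : ∀ i, (u.toOrderHom i : ℕ) = i) (_ : ∀ i, (v.toOrderHom i : ℕ) = i),
      X.pull u v (x.1 b) = x.1 a := by
    rintro a b rfl u v hu hv
    obtain rfl : u = 𝟙 _ := by ext i; exact hu i
    obtain rfl : v = 𝟙 _ := by ext i; exact hv i
    exact X.pull_id _
  refine Subtype.ext (funext fun a => key a _ ?_ _ _ (fun i => rfl) (fun i => ?_))
  · have := a.2
    refine Subtype.ext (Prod.ext rfl ?_)
    change a.1.2 = n.len - a.1.1
    omega
  · change a.1.1 + (i : ℕ) - a.1.1 = i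
    omega

theorem codiagMap_comp {k m n : SimplexCategory} (f : k ⟶ m) (g : m ⟶ n)
    (x : X.codiagSubgroup n.len) :
    X.codiagMap (f ≫ g) x = X.codiagMap f (X.codiagMap g x) := by
  refine Subtype.ext (funext fun a => ?_)
  have e : Anti.upper (f ≫ g) a = Anti.upper f a ≫ Anti.upper g (Anti.target f a) := by
    ext i
    have hi : a.1.1 + (i : ℕ) < k.len + 1 := by have := i.2; have := a.2; dsimp at *; omega
    have hle : (f.toOrderHom ⟨a.1.1, a.le⟩ : ℕ) ≤ f.toOrderHom ⟨a.1.1 + i, hi⟩ :=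
      Fin.le_def.1 (f.toOrderHom.monotone (Fin.mk_le_mk.2 (Nat.le_add_right _ _)))
    have h2 := (f.toOrderHom ⟨a.1.1 + i, hi⟩).2
    change (g.toOrderHom (f.toOrderHom ⟨a.1.1 + i, hi⟩) : ℕ) -
      (g.toOrderHom (f.toOrderHom ⟨a.1.1, a.le⟩) : ℕ) =
      (g.toOrderHom ⟨(f.toOrderHom ⟨a.1.1, a.le⟩ : ℕ) +
        ((f.toOrderHom ⟨a.1.1 + i, hi⟩ : ℕ) - (f.toOrderHom ⟨a.1.1, a.le⟩ : ℕ)), _⟩ : ℕ) -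
      (g.toOrderHom (f.toOrderHom ⟨a.1.1, a.le⟩) : ℕ)
    congr 3
    apply Fin.ext
    dsimp only
    omega
  change X.pull _ _ _ = X.pull _ _ (X.pull _ _ _)
  rw [pull_pull, ← e]
  rfl

/-- The codiagonal of a bisimplicial group. -/
def codiagonal : SimplicialObject GrpCat.{u} where
  obj n := GrpCat.of (X.codiagSubgroup n.unop.len)
  map f := GrpCat.ofHom (X.codiagMap f.unop)
  map_id n := by
    refine GrpCat.hom_ext (MonoidHom.ext fun x => ?_)
    exact X.codiagMap_id _ x
  map_comp f g := by
    refine GrpCat.hom_ext (MonoidHom.ext fun x => ?_)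
    exact X.codiagMap_comp _ _ x

end BisimplicialGroup

end

/-! ### Normal chain complexes, the Moore complex and the mapping cone -/

/-- A normal chain complex of groups: the image of each differential is a normal subgroup. -/
structure NormalChainComplex where
  X : ℕ → Type u
  [group : ∀ n, Group (X n)]
  d : ∀ n, X (n + 1) →* X n
  d_d : ∀ n x, d n (d (n + 1) x) = 1
  normal : ∀ n, (d n).range.Normal

attribute [instance] NormalChainComplex.group

/-- Isomorphisms of normal chain complexes. -/
structure NormalChainComplex.Iso (A B : NormalChainComplex.{u}) where
  equiv : ∀ n, A.X n ≃* B.X n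
  comm : ∀ n x, equiv n (A.d n x) = B.d n (equiv (n + 1) x)

section

open scoped Simplicial

namespace SimplicialGroup

variable (G : SimplicialObject GrpCat.{u})

/-- The face homomorphism `d_i`. -/
def face {n : ℕ} (i : Fin (n + 2)) : G _⦋n + 1⦌ →* G _⦋n⦌ := (G.δ i).hom

/-- The degeneracy homomorphism `s_i`. -/
def degen {n : ℕ} (i : Fin (n + 1)) : G _⦋n⦌ →* G _⦋n + 1⦌ := (G.σ i).hom

/-- The group `NG_n`, the intersection of the kernels of `d_0, …, d_{n-1}`. -/
def mooreSubgroup (n : ℕ) : Subgroup (G _⦋n⦌) :=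
  match n with
  | 0 => ⊤
  | n + 1 => ⨅ i : Fin (n + 1), (face G i.castSucc).ker

variable {G}

theorem mem_moore_succ {n : ℕ} {x : G _⦋n + 1⦌} :
    x ∈ mooreSubgroup G (n + 1) ↔ ∀ i : Fin (n + 1), face G i.castSucc x = 1 := by
  simp [mooreSubgroup, Subgroup.mem_iInf, MonoidHom.mem_ker]

theorem face_face {n : ℕ} {i j : Fin (n + 2)} (h : i ≤ j) (x : G _⦋n + 2⦌) :
    face G i (face G j.succ x) = face G j (face G i.castSucc x) :=
  ConcreteCategory.congr_hom (G.δ_comp_δ h) x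

theorem face_degen_le {n : ℕ} {i : Fin (n + 2)} {j : Fin (n + 1)} (h : i ≤ j.castSucc)
    (x : G _⦋n + 1⦌) : face G i.castSucc (degen G j.succ x) = degen G j (face G i x) :=
  ConcreteCategory.congr_hom (G.δ_comp_σ_of_le h) x

theorem face_degen_self {n : ℕ} (i : Fin (n + 1)) (x : G _⦋n⦌) :
    face G i.castSucc (degen G i x) = x :=
  ConcreteCategory.congr_hom (G.δ_comp_σ_self (i := i)) x

theorem face_degen_succ {n : ℕ} (i : Fin (n + 1)) (x : G _⦋n⦌) :
    face G i.succ (degen G i x) = x :=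
  ConcreteCategory.congr_hom (G.δ_comp_σ_succ (i := i)) x

theorem face_last_mem {n : ℕ} {x : G _⦋n + 1⦌} (hx : x ∈ mooreSubgroup G (n + 1)) :
    face G (Fin.last (n + 1)) x ∈ mooreSubgroup G n := by
  rw [mem_moore_succ] at hx
  cases n with
  | zero => exact Subgroup.mem_top _
  | succ n =>
    refine mem_moore_succ.2 fun i => ?_
    have := face_face (i := i.castSucc) (j := Fin.last (n + 1)) (Fin.le_last _) x
    rw [Fin.succ_last] at this
    rw [this, hx i.castSucc, map_one]

variable (G) in
/-- The differential of the Moore complex, induced by the last face. -/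
def mooreD (n : ℕ) : mooreSubgroup G (n + 1) →* mooreSubgroup G n :=
  ((face G (Fin.last (n + 1))).comp (mooreSubgroup G (n + 1)).subtype).codRestrict _
    fun x => face_last_mem x.2

theorem coe_mooreD (n : ℕ) (x : mooreSubgroup G (n + 1)) :
    (mooreD G n x : G _⦋n⦌) = face G (Fin.last (n + 1)) (x : G _⦋n + 1⦌) := rfl

variable (G) in
/-- The Moore complex of a simplicial group. -/
def mooreComplex : NormalChainComplex.{u} where
  X n := mooreSubgroup G n
  d n := mooreD G n
  d_d n x := by
    have := face_face (i := Fin.last (n + 1)) (j := Fin.last (n + 1)) le_rfl (x : G _⦋n + 2⦌)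
    refine Subtype.ext ?_
    rw [coe_mooreD, coe_mooreD]
    rw [Fin.succ_last] at this
    rw [this, mem_moore_succ.1 x.2, map_one]
    rfl
  normal n := by
    refine ⟨?_⟩
    rintro _ ⟨y, rfl⟩ x
    have hs := face_degen_succ (Fin.last n) (x : G _⦋n⦌)
    rw [Fin.succ_last] at hs
    have hy := mem_moore_succ.1 y.2
    refine ⟨⟨degen G (Fin.last n) x * y * (degen G (Fin.last n) x)⁻¹,
      mem_moore_succ.2 fun i => by simp [hy i]⟩, Subtype.ext ?_⟩
    simp [coe_mooreD, hs]

/-- The action of `NG_0` on `NG_1`: conjugation by `s_0(p)`. -/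
def mooreAct₁ (p : mooreSubgroup G 0) (x : mooreSubgroup G 1) : mooreSubgroup G 1 :=
  ⟨degen G 0 (p : G _⦋0⦌) * (x : G _⦋1⦌) * (degen G 0 (p : G _⦋0⦌))⁻¹,
    mem_moore_succ.2 fun i => by
    simp [mem_moore_succ.1 x.2 i]⟩

/-- The action of `NG_0` on `NG_2`: conjugation by `s_1 s_0(p)`. -/
def mooreAct₂ (p : mooreSubgroup G 0) (y : mooreSubgroup G 2) : mooreSubgroup G 2 :=
  ⟨degen G 1 (degen G 0 (p : G _⦋0⦌)) * (y : G _⦋2⦌) * (degen G 1 (degen G 0 (p : G _⦋0⦌)))⁻¹,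
    mem_moore_succ.2 fun i => by simp [mem_moore_succ.1 y.2 i]⟩

/-- The Peiffer pairing `{x, y} = s_0(x) s_1(y) s_0(x)⁻¹ s_1(x y⁻¹ x⁻¹)` from `NG_1 × NG_1` to
`NG_2`. -/
def peiffer (x y : mooreSubgroup G 1) : mooreSubgroup G 2 :=
  ⟨degen G 0 (x : G _⦋1⦌) * degen G 1 (y : G _⦋1⦌) * (degen G 0 (x : G _⦋1⦌))⁻¹ *
      degen G 1 ((x : G _⦋1⦌) * (y : G _⦋1⦌)⁻¹ * (x : G _⦋1⦌)⁻¹), mem_moore_succ.2 fun i => by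
    have hx : face G 0 (x : G _⦋1⦌) = 1 := mem_moore_succ.1 x.2 0
    have hy : face G 0 (y : G _⦋1⦌) = 1 := mem_moore_succ.1 y.2 0
    have h00 : ∀ z : G _⦋1⦌, face G 0 (degen G 0 z) = z := face_degen_self 0
    have h10 : ∀ z : G _⦋1⦌, face G 1 (degen G 0 z) = z := face_degen_succ 0
    have h11 : ∀ z : G _⦋1⦌, face G 1 (degen G 1 z) = z := face_degen_self 1
    have h01 : ∀ z : G _⦋1⦌, face G 0 (degen G 1 z) = degen G 0 (face G 0 z) :=
      face_degen_le (i := 0) (j := 0) le_rfl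
    fin_cases i
    · change face G 0 _ = 1
      simp [h00, h01, hx, hy]
    · change face G 1 _ = 1
      simp only [map_mul, map_inv, h10, h11]
      group⟩

end SimplicialGroup

end

namespace CrossedSquare

section

variable {L M N P : Type*} [Group L] [Group M] [Group N] [Group P] (C : CrossedSquare L M N P)

/-- The semidirect product `M ⋊ N`, where `N` acts on `M` via `nu`. -/
abbrev MN : Type _ := M ⋊[C.actM.comp C.nu] N

/-- `∂₂(l) = (lam(l)⁻¹, lam'(l))`. -/
def coneD₂ : L →* C.MN where
  toFun l := ⟨(C.lam l)⁻¹, C.lam' l⟩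
  map_one' := by ext <;> simp
  map_mul' l l' := by
    ext
    · simp [nu_lam', C.crossed_mu.peiffer, mul_assoc]
    · simp

/-- `∂₁(m, n) = mu(m) nu(n)`. -/
def coneD₁ : C.MN →* P where
  toFun x := C.mu x.left * C.nu x.right
  map_one' := by simp
  map_mul' x y := by simp [mu_act, mul_assoc]

theorem coneD₁_coneD₂ (l : L) : C.coneD₁ (C.coneD₂ l) = 1 := by
  simp [coneD₁, coneD₂, nu_lam']

theorem coneD₁_normal : C.coneD₁.range.Normal := by
  refine ⟨?_⟩
  rintro _ ⟨⟨m, n⟩, rfl⟩ p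
  exact ⟨⟨C.actM p m, C.actN p n⟩, by simp [coneD₁, mu_act, nu_act]⟩

theorem coneD₂_normal : C.coneD₂.range.Normal := by
  refine ⟨?_⟩
  rintro _ ⟨l, rfl⟩ ⟨m, n⟩
  refine ⟨C.actL (C.nu n) l, ?_⟩
  rw [eq_mul_inv_iff_mul_eq]
  ext
  · simp [coneD₂, lam_act, lam'_act, C.crossed_mu.peiffer, nu_lam',
      C.crossed_nu.peiffer, mul_assoc]
  · simp [coneD₂, lam'_act, C.crossed_nu.peiffer]

end

variable {L M N P : Type u} [Group L] [Group M] [Group N] [Group P] (C : CrossedSquare L M N P)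

/-- The binerve of a crossed square, i.e. of the associated cat²-group. -/
def binerve : BisimplicialGroup.{u} := C.cat2.binerve

/-- The groups of the mapping cone. -/
def coneX : ℕ → Type u
  | 0 => P
  | 1 => C.MN
  | 2 => L
  | _ + 3 => PUnit

instance coneGroup : ∀ n, Group (C.coneX n)
  | 0 => inferInstanceAs (Group P)
  | 1 => inferInstanceAs (Group C.MN)
  | 2 => inferInstanceAs (Group L)
  | _ + 3 => inferInstanceAs (Group PUnit)

/-- The differentials of the mapping cone. -/
def coneD : ∀ n, C.coneX (n + 1) →* C.coneX n
  | 0 => C.coneD₁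
  | 1 => C.coneD₂
  | _ + 2 => 1

/-- The mapping cone `⋯ → 1 → L → M ⋊ N → P` of a crossed square. -/
def mappingCone : NormalChainComplex.{u} where
  X := C.coneX
  d := C.coneD
  d_d n x := match n with
    | 0 => C.coneD₁_coneD₂ x
    | 1 => map_one C.coneD₂
    | _ + 2 => rfl
  normal n := match n with
    | 0 => C.coneD₁_normal
    | 1 => C.coneD₂_normal
    | _ + 2 => by
      change (1 : _ →* _).range.Normal
      rw [MonoidHom.range_one]
      infer_instance

end CrossedSquare

namespace CrossedSquare

variable {L M N P : Type u} [Group L] [Group M] [Group N] [Group P] (C : CrossedSquare L M N P)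

/-- The Moore complex of the codiagonal of the binerve of a crossed square. -/
abbrev NG : NormalChainComplex.{u} := SimplicialGroup.mooreComplex C.binerve.codiagonal

variable {C}

/-- For `x` in `NG_n`, a simplex of the codiagonal, its component `x_{p,q}` with `p + q = n` is a
simplex of the binerve; this is the value of that component at the horizontal arrow `i ≤ i'` and
the vertical arrow `j ≤ j'`, an element `((l, n), (m, p))` of `(L ⋊ N) ⋊ (M ⋊ P)`. -/
def coord {n : ℕ} (x : C.NG.X n) (p q : ℕ) (h : p + q = n) (i i' : Fin (p + 1)) (hi : i ≤ i')
    (j j' : Fin (q + 1)) (hj : j ≤ j') : C.Big :=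
  let y : C.binerve.codiagSubgroup n := x.1
  let z : C.cat2.binerveSubgroup (SimplexCategory.mk p) (SimplexCategory.mk q) := y.1 ⟨(p, q), h⟩
  z.1 ⟨(i, i'), hi⟩ ⟨(j, j'), hj⟩

end CrossedSquare

/-! An `n`-simplex of the codiagonal of a binerve is one family `Y(i, i', j, j')` indexed by chains
`i ≤ i' ≤ j ≤ j'` in `[n]`: the first pair is a horizontal arrow, the second a vertical one, and the
matching conditions say exactly that the value does not depend on the splitting point `p` with `i' ≤
p ≤ j` at which it is read (`component_shift`). Simplicial operators act by substitution on the four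
indices (`glob_codiagMap`), so lying in the Moore subgroup means being trivial on every chain that
avoids some vertex `k < n` (`mem_moore_iff_glob`).

Four indices cannot cover too many vertices. With the composition laws of the two nerves this kills
the Moore subgroup for `n ≥ 3`. In dimension 2 everything is determined by `Y(0, 1, 1, 2)`, an
element killed by both target maps; such elements form a copy of `L` (`eq_square`, `square_mul`). In
dimension 1 the edges `Y(0, 0, 0, 1)` and `Y(0, 1, 1, 1)` contribute `M` and `N`, and in dimension 0
only `P` is left. The differentials are read off from the same values.

The 2-crossed module on the cone has lifting `h(m, n n' n⁻¹)`, and its axioms follow directly from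
those of the crossed square. It agrees with the Peiffer pairing because, in `(L ⋊ N) ⋊ (M ⋊ P)`, `h`
is a commutator of an `M`-edge with an `N`-edge (`square_h_mul`). -/

namespace Cat2Group

open scoped Simplicial

/-! ### Simplices of the codiagonal as families over chains of four indices -/

section IsGlobal

variable {G : Type*} [Group G] (A : Cat2Group G)

/-- The families `Y(i, i', j, j')`, indexed by `i ≤ i' ≤ j ≤ j'` in `[n]`, that describe the
`n`-simplices of the codiagonal of the binerve. -/
structure IsGlobal {n : ℕ} (Y : Fin (n + 1) → Fin (n + 1) → Fin (n + 1) → Fin (n + 1) → G) :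
    Prop where
  source₁ : ∀ i i' j j', i ≤ i' → i' ≤ j → j ≤ j' → A.s₁ (Y i i' j j') = Y i i j j'
  target₁ : ∀ i i' j j', i ≤ i' → i' ≤ j → j ≤ j' → A.t₁ (Y i i' j j') = Y i' i' j j'
  source₂ : ∀ i i' j j', i ≤ i' → i' ≤ j → j ≤ j' → A.s₂ (Y i i' j j') = Y i i' j j
  target₂ : ∀ i i' j j', i ≤ i' → i' ≤ j → j ≤ j' → A.t₂ (Y i i' j j') = Y i i' j' j'
  -- Strict inequalities suffice, since the degenerate cases follow from the source conditions; both
  -- laws are then vacuous for `n ≤ 1`.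
  comp₁ : ∀ i i' i'' j j', i < i' → i' < i'' → i'' ≤ j → j ≤ j' →
    Y i i'' j j' = Y i' i'' j j' * (A.s₁ (Y i' i'' j j'))⁻¹ * Y i i' j j'
  comp₂ : ∀ i i' j j' j'', i ≤ i' → i' ≤ j → j < j' → j' < j'' →
    Y i i' j j'' = Y i i' j' j'' * (A.s₂ (Y i i' j' j''))⁻¹ * Y i i' j j'

end IsGlobal

/-- A family of arrows is a simplex of the nerve if its sources and targets match and the
composition law holds for strictly increasing triples. -/
theorem mem_nerveSubgroup_of_lt {G : Type*} [Group G] {s t : G →* G} (hst : IsCat1Group s t)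
    {n : SimplexCategory} {x : Arr n → G}
    (hs : ∀ i j (hij : i ≤ j), s (x ⟨(i, j), hij⟩) = x ⟨(i, i), le_rfl⟩)
    (ht : ∀ i j (hij : i ≤ j), t (x ⟨(i, j), hij⟩) = x ⟨(j, j), le_rfl⟩)
    (hc : ∀ i j k (hij : i < j) (hjk : j < k),
      x ⟨(i, k), (hij.trans hjk).le⟩ =
        x ⟨(j, k), hjk.le⟩ * (s (x ⟨(j, k), hjk.le⟩))⁻¹ * x ⟨(i, j), hij.le⟩) :
    x ∈ nerveSubgroup hst n := by
  refine ⟨hs, ht, fun i j k hij hjk => ?_⟩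
  rcases hij.eq_or_lt with rfl | hij'
  · rw [hs]; simp
  · rcases hjk.eq_or_lt with rfl | hjk'
    · rw [hs]; simp
    · exact hc i j k hij' hjk'

variable {G : Type u} [Group G] {A : Cat2Group G}

/-- The component of a simplex of the codiagonal at `p + q = n`. -/
def component {n : ℕ} (x : A.binerve.codiagSubgroup n) (p q : ℕ) (h : p + q = n) :
    A.binerveSubgroup ⦋p⦌ ⦋q⦌ :=
  x.1 ⟨(p, q), h⟩

/-- The value of a simplex of the codiagonal at `i ≤ i' ≤ j ≤ j'`: the element at the arrows
`i ≤ i'` and `j - p ≤ j' - p` of its component at `(p, n - p)`, for any `p` with `i' ≤ p ≤ j`. -/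
def glob {n : ℕ} (x : A.binerve.codiagSubgroup n) (i i' j j' : Fin (n + 1)) (h₁ : i ≤ i')
    (h₂ : i' ≤ j) (h₃ : j ≤ j') : G :=
  (component x i' (n - i') (by omega)).1
    ⟨(⟨i, Nat.lt_succ_of_le h₁⟩, ⟨i', Nat.lt_succ_self _⟩), h₁⟩
    ⟨(⟨j - i', by have := j.2; dsimp; omega⟩, ⟨j' - i', by have := j'.2; dsimp; omega⟩),
      Nat.sub_le_sub_right h₃ _⟩

variable {n : ℕ}

/-- This is the matching condition iterated `k` times: moving the splitting point by `k` leaves the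
horizontal arrow alone and shifts the vertical one. Prescribing only the numerical values of the
arrows avoids casts. -/
theorem component_shift (x : A.binerve.codiagSubgroup n) {p q p' q' k : ℕ} (h : p + q = n)
    (h' : p' + q' = n) (hk : p' = p + k) (a : Arr ⦋p⦌) (b : Arr ⦋q'⦌) (a' : Arr ⦋p'⦌)
    (b' : Arr ⦋q⦌) (ha : (a'.1.1 : ℕ) = a.1.1 ∧ (a'.1.2 : ℕ) = a.1.2)
    (hb : (b'.1.1 : ℕ) = b.1.1 + k ∧ (b'.1.2 : ℕ) = b.1.2 + k) :
    (component x p q h).1 a b' = (component x p' q' h').1 a' b := by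
  let f : ⦋p⦌ ⟶ ⦋p'⦌ := SimplexCategory.Hom.mk
    { toFun := fun i => ⟨i, by have := i.2; dsimp at *; omega⟩
      monotone' := fun i j hij => hij }
  let g : ⦋q'⦌ ⟶ ⦋q⦌ := SimplexCategory.Hom.mk
    { toFun := fun i => ⟨i + k, by have := i.2; dsimp at *; omega⟩
      monotone' := fun i j hij => Fin.mk_le_mk.2 (Nat.add_le_add_right (Fin.le_def.1 hij) _) }
  have key := A.binerve.codiag_cond x p q p' q' k h h' hk f (fun _ => rfl) g (fun _ => rfl)
  have e := congrFun (congrFun (congrArg Subtype.val key) a) b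
  have e₁ : Arr.map f a = a' :=
    Subtype.ext (Prod.ext (Fin.ext ha.1.symm) (Fin.ext ha.2.symm))
  have e₂ : Arr.map g b = b' :=
    Subtype.ext (Prod.ext (Fin.ext hb.1.symm) (Fin.ext hb.2.symm))
  rw [← e₁, ← e₂]
  exact e

theorem component_apply (x : A.binerve.codiagSubgroup n) (p q : ℕ) (h : p + q = n)
    (i i' : Fin (p + 1)) (hi : i ≤ i') (j j' : Fin (q + 1)) (hj : j ≤ j') :
    (component x p q h).1 ⟨(i, i'), hi⟩ ⟨(j, j'), hj⟩ =
      glob x ⟨i, by omega⟩ ⟨i', by omega⟩ ⟨p + j, by omega⟩ ⟨p + j', by omega⟩ hi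
        (Fin.mk_le_mk.2 (by omega)) (Fin.mk_le_mk.2 (by have := Fin.le_def.1 hj; omega)) := by
  refine (component_shift x (p := i') (p' := p) (k := p - i') _ _ (by omega) _ _ _ _ ⟨rfl, rfl⟩
    ⟨?_, ?_⟩).symm
  · dsimp; omega
  · dsimp; omega

/-- The free choice of `p` allows several values to be read in one component, where the nerve
conditions relate them. -/
theorem glob_eq_component (x : A.binerve.codiagSubgroup n) (i i' j j' : Fin (n + 1)) (h₁ h₂ h₃)
    (p : ℕ) (hp : i' ≤ p) (hp' : p ≤ j) :
    glob x i i' j j' h₁ h₂ h₃ = (component x p (n - p) (by omega)).1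
      ⟨(⟨i, by have := Fin.le_def.1 h₁; dsimp; omega⟩, ⟨i', by dsimp; omega⟩), h₁⟩
      ⟨(⟨j - p, by dsimp; omega⟩, ⟨j' - p, by dsimp; omega⟩), Nat.sub_le_sub_right h₃ _⟩ := by
  have h₃' := Fin.le_def.1 h₃
  rw [component_apply]
  congr 1 <;> ext <;> dsimp <;> omega

theorem s₁_glob (x : A.binerve.codiagSubgroup n) (i i' j j' : Fin (n + 1)) (h₁ h₂ h₃) :
    A.s₁ (glob x i i' j j' h₁ h₂ h₃) = glob x i i j j' le_rfl (h₁.trans h₂) h₃ := by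
  -- By definition the right side is read at `p = i`; it has to be moved to `p = i'`, where the left
  -- side lives.
  rw [glob_eq_component x i i j j' _ _ _ i' h₁ h₂]
  exact ((component x _ _ _).2.1 _).1 _ _ _

theorem t₁_glob (x : A.binerve.codiagSubgroup n) (i i' j j' : Fin (n + 1)) (h₁ h₂ h₃) :
    A.t₁ (glob x i i' j j' h₁ h₂ h₃) = glob x i' i' j j' le_rfl h₂ h₃ :=
  ((component x _ _ _).2.1 _).2.1 _ _ _

theorem glob_comp₁ (x : A.binerve.codiagSubgroup n) (i i' i'' j j' : Fin (n + 1)) (h₁ : i ≤ i')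
    (h₂ : i' ≤ i'') (h₃ : i'' ≤ j) (h₄ : j ≤ j') :
    glob x i i'' j j' (h₁.trans h₂) h₃ h₄ = glob x i' i'' j j' h₂ h₃ h₄ *
      (A.s₁ (glob x i' i'' j j' h₂ h₃ h₄))⁻¹ * glob x i i' j j' h₁ (h₂.trans h₃) h₄ := by
  rw [glob_eq_component x i i' j j' _ _ _ i'' h₂ h₃]
  exact ((component x _ _ _).2.1 _).2.2 _ _ _ _ _

theorem s₂_glob (x : A.binerve.codiagSubgroup n) (i i' j j' : Fin (n + 1)) (h₁ h₂ h₃) :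
    A.s₂ (glob x i i' j j' h₁ h₂ h₃) = glob x i i' j j h₁ h₂ le_rfl :=
  ((component x _ _ _).2.2 _).1 _ _ _

theorem t₂_glob (x : A.binerve.codiagSubgroup n) (i i' j j' : Fin (n + 1)) (h₁ h₂ h₃) :
    A.t₂ (glob x i i' j j' h₁ h₂ h₃) = glob x i i' j' j' h₁ (h₂.trans h₃) le_rfl :=
  ((component x _ _ _).2.2 _).2.1 _ _ _

theorem glob_comp₂ (x : A.binerve.codiagSubgroup n) (i i' j j' j'' : Fin (n + 1)) (h₁ : i ≤ i')
    (h₂ : i' ≤ j) (h₃ : j ≤ j') (h₄ : j' ≤ j'') :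
    glob x i i' j j'' h₁ h₂ (h₃.trans h₄) = glob x i i' j' j'' h₁ (h₂.trans h₃) h₄ *
      (A.s₂ (glob x i i' j' j'' h₁ (h₂.trans h₃) h₄))⁻¹ * glob x i i' j j' h₁ h₂ h₃ :=
  ((component x _ _ _).2.2 _).2.2 _ _ _ _ _

theorem codiag_ext {x y : A.binerve.codiagSubgroup n}
    (h : ∀ i i' j j' h₁ h₂ h₃, glob x i i' j j' h₁ h₂ h₃ = glob y i i' j j' h₁ h₂ h₃) :
    x = y := by
  refine Subtype.ext (funext ?_)
  rintro ⟨⟨p, q⟩, hpq⟩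
  refine Subtype.ext (funext ?_)
  rintro ⟨⟨i, i'⟩, hi⟩
  refine funext ?_
  rintro ⟨⟨j, j'⟩, hj⟩
  exact (component_apply x p q hpq i i' hi j j' hj).trans
    ((h _ _ _ _ _ _ _).trans (component_apply y p q hpq i i' hi j j' hj).symm)

/-- The component at `i'` is pulled back from the one at `f(i')`, which is again the default
splitting point. Only the vertical offsets need checking: `f(i' + (j - i')) - f(i') = f(j) - f(i')`.
-/
theorem glob_codiagMap {m n : SimplexCategory} (f : m ⟶ n) (x : A.binerve.codiagSubgroup n.len)
    (i i' j j' : Fin (m.len + 1)) (h₁ h₂ h₃) :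
    glob (A.binerve.codiagMap f x) i i' j j' h₁ h₂ h₃ =
      glob x (f.toOrderHom i) (f.toOrderHom i') (f.toOrderHom j) (f.toOrderHom j')
        (f.toOrderHom.monotone h₁) (f.toOrderHom.monotone h₂) (f.toOrderHom.monotone h₃) := by
  have hj : (⟨i' + (j - i'), by omega⟩ : Fin (m.len + 1)) = j :=
    Fin.ext (Nat.add_sub_cancel' h₂)
  have hj' : (⟨i' + (j' - i'), by have := Fin.le_def.1 h₃; omega⟩ : Fin (m.len + 1)) = j' :=
    Fin.ext (Nat.add_sub_cancel' (h₂.trans h₃))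
  refine congrArg ((component x (f.toOrderHom i') (n.len - f.toOrderHom i') (by omega)).1 _)
    (Subtype.ext (Prod.ext (Fin.ext ?_) (Fin.ext ?_)))
  · exact congrArg (fun z => (f.toOrderHom z : ℕ) - f.toOrderHom i') hj
  · exact congrArg (fun z => (f.toOrderHom z : ℕ) - f.toOrderHom i') hj'

variable {Y : Fin (n + 1) → Fin (n + 1) → Fin (n + 1) → Fin (n + 1) → G}

/-- The simplex of the codiagonal with prescribed values. -/
def ofGlobal (hY : A.IsGlobal Y) : A.binerve.codiagSubgroup n where
  val a := ⟨fun u v => Y ⟨u.1.1, by have := a.2; have := u.1.1.2; dsimp at *; omega⟩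
      ⟨u.1.2, by have := a.2; have := u.1.2.2; dsimp at *; omega⟩
      ⟨a.1.1 + v.1.1, by have := a.2; have := v.1.1.2; dsimp at *; omega⟩
      ⟨a.1.1 + v.1.2, by have := a.2; have := v.1.2.2; dsimp at *; omega⟩, by
    obtain ⟨⟨p, q⟩, h⟩ := a
    constructor
    · rintro ⟨⟨j, j'⟩, hj⟩
      have hj' := Nat.add_le_add_left (Fin.le_def.1 hj) p
      have hp : ∀ i : Fin (p + 1), (i : ℕ) ≤ p + j := fun i => by omega
      exact mem_nerveSubgroup_of_lt _
        (fun i i' hi => hY.source₁ _ _ _ _ hi (hp i') hj')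
        (fun i i' hi => hY.target₁ _ _ _ _ hi (hp i') hj')
        (fun i i' i'' hi hi' => hY.comp₁ _ _ _ _ _ hi hi' (hp i'') hj')
    · rintro ⟨⟨i, i'⟩, hi⟩
      have hp : ∀ j : Fin (q + 1), (i' : ℕ) ≤ p + j := fun j => by
        have := i'.2; dsimp at *; omega
      have hq : ∀ {j j' : Fin (q + 1)}, j ≤ j' → p + (j : ℕ) ≤ p + j' :=
        fun h => Nat.add_le_add_left h p
      have hq' : ∀ {j j' : Fin (q + 1)}, j < j' → p + (j : ℕ) < p + j' :=
        fun h => Nat.add_lt_add_left h p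
      exact mem_nerveSubgroup_of_lt _
        (fun j j' hj => hY.source₂ _ _ _ _ hi (hp j) (hq hj))
        (fun j j' hj => hY.target₂ _ _ _ _ hi (hp j) (hq hj))
        (fun j j' j'' hj hj' => hY.comp₂ _ _ _ _ _ hi (hp j) (hq' hj) (hq' hj'))⟩
  property p q h := by
    refine Subtype.ext (funext fun u => funext fun v => ?_)
    have hl : ∀ i : Fin (p + 1), ((Fin.last (p + 1)).succAbove i : ℕ) = i := fun i => by simp
    have hr : ∀ j : Fin (q + 1), p + ((0 : Fin (q + 2)).succAbove j : ℕ) = p + 1 + j :=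
      fun j => by simp; omega
    -- Both faces read the same value of `Y`: skipping the last vertex changes no index, and
    -- skipping vertex `0` adds one, which matches the offset `p + 1` on the other side.
    change Y ⟨(u.1.1 : ℕ), _⟩ ⟨(u.1.2 : ℕ), _⟩ ⟨p + ((0 : Fin (q + 2)).succAbove v.1.1 : ℕ), _⟩
        ⟨p + ((0 : Fin (q + 2)).succAbove v.1.2 : ℕ), _⟩ =
      Y ⟨((Fin.last (p + 1)).succAbove u.1.1 : ℕ), _⟩
        ⟨((Fin.last (p + 1)).succAbove u.1.2 : ℕ), _⟩ ⟨p + 1 + (v.1.1 : ℕ), _⟩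
        ⟨p + 1 + (v.1.2 : ℕ), _⟩
    congr 1 <;> simp only [hl, hr]

theorem glob_ofGlobal (hY : A.IsGlobal Y) (i i' j j' : Fin (n + 1)) (h₁ h₂ h₃) :
    glob (ofGlobal hY) i i' j j' h₁ h₂ h₃ = Y i i' j j' := by
  have h₃' := Fin.le_def.1 h₃
  change Y _ _ ⟨i' + (j - i'), _⟩ ⟨i' + (j' - i'), _⟩ = _
  congr 1 <;> ext <;> dsimp <;> omega

end Cat2Group

/-! ### The Moore subgroups in terms of chains, and their vanishing from dimension three on -/

namespace Cat2Group

open scoped Simplicial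
open SimplicialGroup

variable {G : Type u} [Group G] {A : Cat2Group G} {n : ℕ}

theorem glob_face (k : Fin (n + 2)) (x : A.binerve.codiagonal _⦋n + 1⦌)
    (i i' j j' : Fin (n + 1)) (h₁ h₂ h₃) :
    glob (n := n) (face A.binerve.codiagonal k x) i i' j j' h₁ h₂ h₃ =
      glob (n := n + 1) x (k.succAbove i) (k.succAbove i') (k.succAbove j) (k.succAbove j')
        ((Fin.strictMono_succAbove k).monotone h₁) ((Fin.strictMono_succAbove k).monotone h₂)
        ((Fin.strictMono_succAbove k).monotone h₃) :=
  glob_codiagMap (SimplexCategory.δ k) x i i' j j' h₁ h₂ h₃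

/-- The values of `d_k x` are those of `x` on the chains that avoid the vertex `k`. -/
theorem mem_moore_iff_glob {x : A.binerve.codiagSubgroup (n + 1)} :
    (show A.binerve.codiagonal _⦋n + 1⦌ from x) ∈ mooreSubgroup A.binerve.codiagonal (n + 1) ↔
      ∀ (k : Fin (n + 1)) (i i' j j' : Fin (n + 2)) (h₁ h₂ h₃), i ≠ k.castSucc → i' ≠ k.castSucc →
        j ≠ k.castSucc → j' ≠ k.castSucc → glob x i i' j j' h₁ h₂ h₃ = 1 := by
  rw [mem_moore_succ]
  refine forall_congr' fun k => ⟨fun h i i' j j' h₁ h₂ h₃ hi hi' hj hj' => ?_, fun h => ?_⟩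
  · obtain ⟨i, rfl⟩ := Fin.exists_succAbove_eq hi
    obtain ⟨i', rfl⟩ := Fin.exists_succAbove_eq hi'
    obtain ⟨j, rfl⟩ := Fin.exists_succAbove_eq hj
    obtain ⟨j', rfl⟩ := Fin.exists_succAbove_eq hj'
    rw [Fin.succAbove_le_succAbove_iff] at h₁ h₂ h₃
    rw [← glob_face k.castSucc x i i' j j' h₁ h₂ h₃]
    exact congrArg (fun z : A.binerve.codiagSubgroup n => glob z i i' j j' h₁ h₂ h₃) h
  · refine codiag_ext fun i i' j j' h₁ h₂ h₃ => ?_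
    refine (glob_face k.castSucc x i i' j j' h₁ h₂ h₃).trans ?_
    exact h _ _ _ _ _ _ _ (Fin.succAbove_ne _ _) (Fin.succAbove_ne _ _) (Fin.succAbove_ne _ _)
      (Fin.succAbove_ne _ _)

theorem mooreSubgroup_codiagonal_eq_bot (n : ℕ) (hn : 3 ≤ n) :
    mooreSubgroup A.binerve.codiagonal n = ⊥ := by
  obtain ⟨n, rfl⟩ : ∃ m, n = m + 1 := ⟨n - 1, by omega⟩
  refine (Subgroup.eq_bot_iff_forall _).2 fun x hx => ?_
  have H := mem_moore_iff_glob.1 hx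
  have avoid : ∀ a b c d : ℕ, (¬ (a = 0 ∨ b = 0 ∨ c = 0 ∨ d = 0) ∨
      ¬ (a = 1 ∨ b = 1 ∨ c = 1 ∨ d = 1) ∨ ¬ (a = 2 ∨ b = 2 ∨ c = 2 ∨ d = 2) ∨
      3 < n + 1 ∧ ¬ (a = 3 ∨ b = 3 ∨ c = 3 ∨ d = 3)) →
      ∃ k < n + 1, a ≠ k ∧ b ≠ k ∧ c ≠ k ∧ d ≠ k := by
    rintro a b c d (h | h | h | ⟨h', h⟩)
    · exact ⟨0, by omega, by omega⟩
    · exact ⟨1, by omega, by omega⟩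
    · exact ⟨2, by omega, by omega⟩
    · exact ⟨3, by omega, by omega⟩
  have H' : ∀ (i i' j j' : Fin (n + 2)) (h₁ h₂ h₃), (∃ k < n + 1, (i : ℕ) ≠ k ∧ (i' : ℕ) ≠ k ∧
      (j : ℕ) ≠ k ∧ (j' : ℕ) ≠ k) → glob (n := n + 1) x i i' j j' h₁ h₂ h₃ = 1 := by
    rintro i i' j j' h₁ h₂ h₃ ⟨k, hk, hi, hi', hj, hj'⟩
    exact H ⟨k, hk⟩ i i' j j' h₁ h₂ h₃ (fun h => hi (Fin.ext_iff.1 h))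
      (fun h => hi' (Fin.ext_iff.1 h)) (fun h => hj (Fin.ext_iff.1 h))
      (fun h => hj' (Fin.ext_iff.1 h))
  -- When the last index is the top vertex, only three are left to cover `0, …, n`. This is possible
  -- only for the chain `0 < 1 < 2 < 3` in dimension 3.
  have hlast : ∀ (i i' j : Fin (n + 2)) (h₁ h₂),
      glob (n := n + 1) x i i' j (Fin.last _) h₁ h₂ (Fin.le_last _) = 1 := by
    intro i i' j h₁ h₂
    have hl : (Fin.last (n + 1) : ℕ) = n + 1 := rfl
    by_cases h : n = 2 ∧ (i : ℕ) = 0 ∧ (i' : ℕ) = 1 ∧ (j : ℕ) = 2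
    · obtain ⟨rfl, hi, hi', hj⟩ := h
      have := glob_comp₁ (n := 3) x i i' j j (Fin.last _) h₁ h₂ le_rfl (Fin.le_last _)
      -- `Y(0, 2, 2, 3)` avoids `1` and `Y(1, 2, 2, 3)` avoids `0`, so horizontal composition forces
      -- `Y(0, 1, 2, 3) = 1`.
      rw [H' i j j (Fin.last _) _ _ _ ⟨1, by omega, by omega⟩,
        H' i' j j (Fin.last _) _ _ _ ⟨0, by omega, by omega⟩] at this
      simpa using this.symm
    · refine H' _ _ _ _ _ _ _ (avoid _ _ _ _ ?_)
      have := Fin.le_def.1 h₁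
      have := Fin.le_def.1 h₂
      omega
  refine codiag_ext (n := n + 1) fun i i' j j' h₁ h₂ h₃ => ?_
  -- A general vertical arrow is extended to the top vertex; the composite and the added arrow are
  -- both trivial.
  have := glob_comp₂ (n := n + 1) x i i' j j' (Fin.last _) h₁ h₂ h₃ (Fin.le_last _)
  rw [hlast, hlast] at this
  exact (by simpa using this.symm : glob (n := n + 1) x i i' j j' h₁ h₂ h₃ = 1)

end Cat2Group

/-! ### The mapping cone as a 2-crossed module -/

namespace CrossedSquare

section

variable {L M N P : Type*} [Group L] [Group M] [Group N] [Group P] (C : CrossedSquare L M N P)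

theorem h_inv_right (m : M) (n : N) : C.h m n⁻¹ = C.actL (C.nu n)⁻¹ (C.h m n)⁻¹ := by
  have := C.h_mul_right m n n⁻¹
  rw [mul_inv_cancel, h_one_right, eq_comm, mul_eq_one_iff_inv_eq] at this
  rw [this, ← MulAut.mul_apply, ← map_mul, inv_mul_cancel, map_one, MulAut.one_apply]

theorem h_inv_left (m : M) (n : N) : C.actL (C.mu m) (C.h m⁻¹ n) = (C.h m n)⁻¹ := by
  have := C.h_mul_left m m⁻¹ n
  rw [mul_inv_cancel, h_one_left, eq_comm, mul_eq_one_iff_eq_inv] at this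
  exact this

/-- Through `nu`, the element `lam'(l)` acts on `L` as conjugation by `l`. -/
theorem actL_nu_conj_lam' (l l' : L) (n : N) :
    C.actL (C.nu (C.lam' l * n * (C.lam' l)⁻¹)) l' =
      l * C.actL (C.nu n) (l⁻¹ * l' * l) * l⁻¹ := by
  have e : C.actL (C.nu (C.lam' l))⁻¹ l' = l⁻¹ * l' * l := by
    rw [← map_inv, ← map_inv, nu_lam', act_kappa, inv_inv]
  simp only [map_mul, MulAut.mul_apply, map_inv C.nu, e]
  simp only [nu_lam', act_kappa]
  simp [mul_assoc]

theorem h_inv_lam (l : L) (n : N) : C.h (C.lam l)⁻¹ n = l⁻¹ * C.actL (C.nu n) l := by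
  rw [← map_inv, h_lam, inv_inv]

theorem actM_mu_symm (m m' : M) : (C.actM (C.mu m)).symm m' = m⁻¹ * m' * m := by
  rw [MulEquiv.symm_apply_eq, C.crossed_mu.peiffer]
  group

/-- The action of `P` on `M ⋊ N` in each coordinate. -/
def actMN : P →* MulAut C.MN where
  toFun p :=
    { toFun := fun x => ⟨C.actM p x.left, C.actN p x.right⟩
      invFun := fun x => ⟨C.actM p⁻¹ x.left, C.actN p⁻¹ x.right⟩
      left_inv := fun x => by ext <;> simp
      right_inv := fun x => by ext <;> simp
      map_mul' := fun x y => by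
        ext
        · simp [nu_act]
        · simp }
  map_one' := by ext <;> simp
  map_mul' p q := by ext <;> simp

@[simp]
theorem actMN_left (p : P) (x : C.MN) : (C.actMN p x).left = C.actM p x.left := rfl

@[simp]
theorem actMN_right (p : P) (x : C.MN) : (C.actMN p x).right = C.actN p x.right := rfl

/-- The mapping cone of a crossed square as a 2-crossed module, with Peiffer lifting
`{(m, n), (m', n')} = h(m, n n' n⁻¹)`. -/
def coneTwoCrossedModule : TwoCrossedModule L C.MN P where
  d₂ := C.coneD₂
  d₁ := C.coneD₁
  actL := C.actL
  actM := C.actMN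
  lift x y := C.h x.left (x.right * y.right * x.right⁻¹)
  d₁_d₂ := C.coneD₁_coneD₂
  d₂_equivariant p l := by ext <;> simp [coneD₂, lam_act, lam'_act]
  d₁_equivariant p x := by simp [coneD₁, mu_act, nu_act]
  d₂_lift x y := by
    rw [← mul_assoc, ← mul_assoc, eq_mul_inv_iff_mul_eq, eq_mul_inv_iff_mul_eq]
    obtain ⟨m, n⟩ := x
    obtain ⟨m', n'⟩ := y
    ext
    · simp [coneD₂, coneD₁, lam_h, nu_lam', nu_act, mul_assoc, C.crossed_mu.peiffer, actM_mu_symm]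
    · simp [coneD₂, coneD₁, lam'_h, mul_assoc, C.crossed_nu.peiffer]
  lift_d₂_d₂ l l' := by
    simp only [coneD₂, MonoidHom.coe_mk, OneHom.coe_mk, ← map_mul, ← map_inv, h_lam', act_kappa]
    group
  lift_mul_left x y z := by
    simp only [SemidirectProduct.mul_left, SemidirectProduct.mul_right,
      SemidirectProduct.inv_right, MonoidHom.comp_apply, h_mul_left, coneD₁, MonoidHom.coe_mk,
      OneHom.coe_mk, map_mul, MulAut.mul_apply, ← C.h_equivariant (C.nu x.right),
      C.crossed_nu.peiffer]
    simp only [mul_inv_rev, mul_assoc]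
  lift_mul_right x y z := by
    -- The action `(y, l) ↦ {∂₂ l, y} l` of `M ⋊ N` on `L` is just the action of the `N`-coordinate
    -- through `nu`. The axiom thereby becomes `h_mul_right`.
    have key : ∀ (l : L) (a : N), C.h (C.coneD₂ l).left
        ((C.coneD₂ l).right * a * (C.coneD₂ l).right⁻¹) * l = C.actL (C.nu a) l := by
      intro l a
      simp only [coneD₂, MonoidHom.coe_mk, OneHom.coe_mk, h_inv_lam, actL_nu_conj_lam']
      group
    have e : (x * y * x⁻¹).right = x.right * y.right * x.right⁻¹ := by simp
    rw [e, key, ← h_mul_right]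
    congr 1
    simp only [SemidirectProduct.mul_right]
    group
  lift_d₂_mul_lift_d₂ x l := by
    -- Writing `n lam'(l) n⁻¹` as `lam'` of a translate of `l` makes `h_lam'` applicable; the two
    -- factors then telescope.
    simp only [coneD₂, MonoidHom.coe_mk, OneHom.coe_mk, h_inv_lam, actL_nu_conj_lam', coneD₁,
      ← C.crossed_nu.peiffer x.right, ← lam'_act, h_lam']
    simp [mul_assoc]
  lift_equivariant p x y := by
    simp only [← h_equivariant, actMN_left, actMN_right, map_mul, map_inv]

/-! ### The cat²-group of a crossed square in coordinates -/

@[simp]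
theorem cat2_s₁ (g : C.Big) : C.cat2.s₁ g = ⟨1, g.right⟩ := rfl

@[simp]
theorem cat2_t₁ (g : C.Big) : C.cat2.t₁ g = ⟨1, C.bdLN g.left * g.right⟩ := rfl

@[simp]
theorem cat2_s₂ (g : C.Big) : C.cat2.s₂ g = ⟨⟨1, g.left.right⟩, ⟨1, g.right.right⟩⟩ := rfl

@[simp]
theorem cat2_t₂ (g : C.Big) : C.cat2.t₂ g =
    ⟨⟨1, C.lam' g.left.left * g.left.right⟩, ⟨1, C.mu g.right.left * g.right.right⟩⟩ := rfl

/-- The element `((l, lam'(l)⁻¹), (lam(l)⁻¹, mu(lam(l))))` of `(L ⋊ N) ⋊ (M ⋊ P)`. -/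
def square (l : L) : C.Big := ⟨⟨l, (C.lam' l)⁻¹⟩, ⟨(C.lam l)⁻¹, C.mu (C.lam l)⟩⟩

/-- The vertical target determines `n` from `l` and `p` from `m`; the `M`-coordinate of the
horizontal target then determines `m` from `l`. -/
theorem eq_square {g : C.Big} (h₁ : C.cat2.t₁ g = 1) (h₂ : C.cat2.t₂ g = 1) :
    g = C.square g.left.left := by
  obtain ⟨⟨l, n⟩, ⟨m, p⟩⟩ := g
  have hn : C.lam' l * n = 1 := congrArg (fun z : C.Big => z.left.right) h₂
  have hp : C.mu m * p = 1 := congrArg (fun z : C.Big => z.right.right) h₂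
  have hm : C.lam l * C.actM (C.nu n) m = 1 := congrArg (fun z : C.Big => z.right.left) h₁
  obtain rfl : n = (C.lam' l)⁻¹ := eq_inv_of_mul_eq_one_right hn
  rw [map_inv, nu_lam', ← map_inv, C.crossed_mu.peiffer] at hm
  obtain rfl : m = (C.lam l)⁻¹ := by
    rw [inv_inv, mul_assoc, mul_inv_cancel_left, mul_eq_one_iff_eq_inv] at hm
    exact hm
  obtain rfl : p = C.mu (C.lam l) := by
    rw [map_inv, inv_mul_eq_one] at hp
    exact hp.symm
  rfl

theorem t₁_square (l : L) : C.cat2.t₁ (C.square l) = 1 := by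
  ext
  · rfl
  · rfl
  · simp [square, bdLN, nu_lam', actM_mu_symm]
  · simp [square, bdLN, nu_lam']

theorem t₂_square (l : L) : C.cat2.t₂ (C.square l) = 1 := by
  ext <;> simp [square]

/-- Both target maps kill the product, so by `eq_square` only the `L`-coordinate has to be computed.
-/
theorem square_mul (l l' : L) : C.square l * C.square l' = C.square (l * l') := by
  have h₁ : C.cat2.t₁ (C.square l * C.square l') = 1 := by
    rw [map_mul, t₁_square, t₁_square, mul_one]
  have h₂ : C.cat2.t₂ (C.square l * C.square l') = 1 := by
    rw [map_mul, t₂_square, t₂_square, mul_one]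
  rw [C.eq_square h₁ h₂]
  congr 1
  change l * C.actL (C.nu (C.lam' l)⁻¹) (C.actL (C.mu (C.lam l)⁻¹ * C.mu (C.lam l)) l' *
    C.h (C.lam l)⁻¹ (C.actN (C.mu (C.lam l)) (C.lam' l')⁻¹)) = l * l'
  simp only [← map_mul, ← map_inv, ← lam'_act, nu_lam', act_kappa, h_lam, inv_mul_cancel, map_one,
    MulAut.one_apply]
  group

end

end CrossedSquare

/-! ### The Moore subgroups in dimensions at most two -/

theorem forall_chain_two {Q : Fin 2 → Fin 2 → Fin 2 → Fin 2 → Prop} (h₁ : Q 0 0 0 0)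
    (h₂ : Q 0 0 0 1) (h₃ : Q 0 0 1 1) (h₄ : Q 0 1 1 1) (h₅ : Q 1 1 1 1) (i i' j j' : Fin 2)
    (hi : i ≤ i') (hj : i' ≤ j) (hj' : j ≤ j') : Q i i' j j' := by
  revert i i' j j'
  simp only [Fin.forall_fin_two, Fin.isValue]
  simp [*]

theorem forall_chain_three {Q : Fin 3 → Fin 3 → Fin 3 → Fin 3 → Prop} (h₁ : Q 0 0 0 0)
    (h₂ : Q 0 0 0 1) (h₃ : Q 0 0 0 2) (h₄ : Q 0 0 1 1) (h₅ : Q 0 0 1 2) (h₆ : Q 0 0 2 2)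
    (h₇ : Q 0 1 1 1) (h₈ : Q 0 1 1 2) (h₉ : Q 0 1 2 2) (h₁₀ : Q 0 2 2 2) (h₁₁ : Q 1 1 1 1)
    (h₁₂ : Q 1 1 1 2) (h₁₃ : Q 1 1 2 2) (h₁₄ : Q 1 2 2 2) (h₁₅ : Q 2 2 2 2) (i i' j j' : Fin 3)
    (hi : i ≤ i') (hj : i' ≤ j) (hj' : j ≤ j') : Q i i' j j' := by
  fin_cases i <;> fin_cases i' <;> first | exact absurd hi (by decide) | skip
  all_goals fin_cases j <;> first | exact absurd hj (by decide) | skip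
  all_goals fin_cases j' <;> first | exact absurd hj' (by decide) | assumption

namespace CrossedSquare

open scoped Simplicial
open SimplicialGroup Cat2Group

variable {L M N P : Type u} [Group L] [Group M] [Group N] [Group P] {C : CrossedSquare L M N P}

theorem eq_one_of_mem_moore {n : ℕ} (x : mooreSubgroup C.binerve.codiagonal (n + 1))
    (k : Fin (n + 1)) (i i' j j' : Fin (n + 2)) (h₁ h₂ h₃) (hi : i ≠ k.castSucc)
    (hi' : i' ≠ k.castSucc) (hj : j ≠ k.castSucc) (hj' : j' ≠ k.castSucc) :
    glob (A := C.cat2) (n := n + 1) x.1 i i' j j' h₁ h₂ h₃ = 1 :=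
  mem_moore_iff_glob.1 x.2 k i i' j j' h₁ h₂ h₃ hi hi' hj hj'

/-! ### Dimension zero -/

section Zero

/-- The value at the vertex of a `0`-simplex. -/
def vertex (x : mooreSubgroup C.binerve.codiagonal 0) : C.Big :=
  glob (A := C.cat2) (n := 0) x.1 0 0 0 0 le_rfl le_rfl le_rfl

/-- A vertex is an identity arrow in both directions, so both source maps fix it. -/
theorem vertex_eq (x : mooreSubgroup C.binerve.codiagonal 0) :
    vertex x = ⟨1, ⟨1, (vertex x).right.right⟩⟩ := by
  have h₁ : C.cat2.s₁ (vertex x) = vertex x := s₁_glob (A := C.cat2) (n := 0) x.1 _ _ _ _ _ _ _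
  have h₂ : C.cat2.s₂ (vertex x) = vertex x := s₂_glob (A := C.cat2) (n := 0) x.1 _ _ _ _ _ _ _
  have h₃ := congrArg (fun z : C.Big => z.left) h₁
  have h₄ := congrArg (fun z : C.Big => z.right.left) h₂
  ext1
  · exact h₃.symm
  · ext1
    · exact h₄.symm
    · rfl

variable (C) in
theorem isGlobal_zero (p : P) :
    C.cat2.IsGlobal (n := 0) fun _ _ _ _ => (⟨1, ⟨1, p⟩⟩ : C.Big) where
  source₁ _ _ _ _ _ _ _ := rfl
  target₁ _ _ _ _ _ _ _ := by simp
  source₂ _ _ _ _ _ _ _ := rfl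
  target₂ _ _ _ _ _ _ _ := by simp
  comp₁ i i' _ _ _ h := absurd h (by omega)
  comp₂ _ _ j j' _ _ _ h := absurd h (by omega)

variable (C) in
/-- `NG_0` is `P`. -/
def mooreZeroEquiv : mooreSubgroup C.binerve.codiagonal 0 ≃* P where
  toFun x := (vertex x).right.right
  invFun p := ⟨ofGlobal (C.isGlobal_zero p), Subgroup.mem_top _⟩
  left_inv x := by
    refine Subtype.ext (codiag_ext (A := C.cat2) (n := 0) fun i i' j j' h₁ h₂ h₃ => ?_)
    obtain rfl : i = 0 := by omega
    obtain rfl : i' = 0 := by omega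
    obtain rfl : j = 0 := by omega
    obtain rfl : j' = 0 := by omega
    exact (vertex_eq x).symm
  right_inv p := rfl
  map_mul' x y := rfl

end Zero

/-! ### Dimension one -/

section One

/-- The value at `(0, 0, 0, 1)` of an element of `NG_1`. -/
def vEdge (x : mooreSubgroup C.binerve.codiagonal 1) : C.Big :=
  glob (A := C.cat2) (n := 1) x.1 0 0 0 1 (by decide) (by decide) (by decide)

/-- The value at `(0, 1, 1, 1)` of an element of `NG_1`. -/
def hEdge (x : mooreSubgroup C.binerve.codiagonal 1) : C.Big :=
  glob (A := C.cat2) (n := 1) x.1 0 1 1 1 (by decide) (by decide) (by decide)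

/-- The edge is vertically degenerate, and its horizontal target `Y(1, 1, 1, 1)` is trivial because
it avoids `0`. -/
theorem hEdge_eq (x : mooreSubgroup C.binerve.codiagonal 1) :
    hEdge x = ⟨⟨1, (hEdge x).left.right⟩, ⟨1, C.nu (hEdge x).left.right⁻¹⟩⟩ := by
  have h₁ : C.cat2.t₁ (hEdge x) = 1 := (t₁_glob (A := C.cat2) (n := 1) x.1 _ _ _ _ _ _ _).trans
    (eq_one_of_mem_moore x 0 _ _ _ _ _ _ _ (by decide) (by decide) (by decide) (by decide))
  have h₂ : C.cat2.s₂ (hEdge x) = hEdge x := s₂_glob (A := C.cat2) (n := 1) x.1 _ _ _ _ _ _ _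
  have h₃ := congrArg (fun z : C.Big => z.left.left) h₂
  have h₄ := congrArg (fun z : C.Big => z.right.left) h₂
  have h₅ : C.nu (hEdge x).left.right * (hEdge x).right.right = 1 :=
    congrArg (fun z : C.Big => z.right.right) h₁
  ext
  · exact h₃.symm
  · rfl
  · exact h₄.symm
  · rw [map_inv]
    exact eq_inv_of_mul_eq_one_right h₅

/-- The edge is horizontally degenerate, and the two edges meet: the vertical target of this one is
the horizontal source `Y(0, 0, 1, 1)` of the other. -/
theorem vEdge_eq (x : mooreSubgroup C.binerve.codiagonal 1) :
    vEdge x = ⟨1, ⟨(vEdge x).right.left,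
      C.mu (vEdge x).right.left⁻¹ * C.nu (hEdge x).left.right⁻¹⟩⟩ := by
  have h₁ : C.cat2.s₁ (vEdge x) = vEdge x := s₁_glob (A := C.cat2) (n := 1) x.1 _ _ _ _ _ _ _
  have h₂ : C.cat2.t₂ (vEdge x) = C.cat2.s₁ (hEdge x) :=
    (t₂_glob (A := C.cat2) (n := 1) x.1 _ _ _ _ _ _ _).trans
      (s₁_glob (A := C.cat2) (n := 1) x.1 _ _ _ _ _ _ _).symm
  rw [hEdge_eq] at h₂
  have h₃ := congrArg (fun z : C.Big => z.left) h₁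
  have h₄ : C.mu (vEdge x).right.left * (vEdge x).right.right = C.nu (hEdge x).left.right⁻¹ :=
    congrArg (fun z : C.Big => z.right.right) h₂
  ext1
  · exact h₃.symm
  · ext1
    · rfl
    · rw [← h₄, map_inv, inv_mul_cancel_left]

theorem eq_one_of_edges {x : mooreSubgroup C.binerve.codiagonal 1} (hv : vEdge x = 1)
    (hh : hEdge x = 1) : x = 1 := by
  refine Subtype.ext (codiag_ext (A := C.cat2) (n := 1) ?_)
  intro i i' j j' h₁ h₂ h₃
  refine forall_chain_two (Q := fun i i' j j' => ∀ h₁ h₂ h₃,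
    glob (A := C.cat2) (n := 1) x.1 i i' j j' h₁ h₂ h₃ = 1) ?_ ?_ ?_ ?_ ?_ i i' j j' h₁ h₂ h₃
    h₁ h₂ h₃
  · intro _ _ _
    exact (s₂_glob (A := C.cat2) (n := 1) x.1 0 0 0 1 _ _ _).symm.trans
      ((congrArg _ hv).trans (map_one _))
  · exact fun _ _ _ => hv
  · intro _ _ _
    exact (s₁_glob (A := C.cat2) (n := 1) x.1 0 1 1 1 _ _ _).symm.trans
      ((congrArg _ hh).trans (map_one _))
  · exact fun _ _ _ => hh
  · exact fun h₁ h₂ h₃ => eq_one_of_mem_moore x 0 _ _ _ _ h₁ h₂ h₃ (by decide) (by decide)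
      (by decide) (by decide)

variable (C) in
/-- The values of the element of `NG_1` that corresponds to `(m, n)`. -/
def globalOne (x : C.MN) : Fin 2 → Fin 2 → Fin 2 → Fin 2 → C.Big := fun i i' j j' =>
  match i, i', j, j' with
  | 0, 0, 0, 0 => ⟨1, ⟨1, C.mu x.left * C.nu x.right⟩⟩
  | 0, 0, 0, 1 => ⟨1, ⟨x.left⁻¹, C.mu x.left * C.nu x.right⟩⟩
  | 0, 0, 1, 1 => ⟨1, ⟨1, C.nu x.right⟩⟩
  | 0, 1, 1, 1 => ⟨⟨1, x.right⁻¹⟩, ⟨1, C.nu x.right⟩⟩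
  -- Among chains this covers only `(1, 1, 1, 1)`; on all other quadruples the value is a dummy.
  | _, _, _, _ => 1

theorem isGlobal_one (x : C.MN) : C.cat2.IsGlobal (n := 1) (C.globalOne x) where
  source₁ := by refine forall_chain_two ?_ ?_ ?_ ?_ ?_ <;> simp [globalOne]
  target₁ := by refine forall_chain_two ?_ ?_ ?_ ?_ ?_ <;> simp [globalOne, bdLN]
  source₂ := by refine forall_chain_two ?_ ?_ ?_ ?_ ?_ <;> simp [globalOne]
  target₂ := by refine forall_chain_two ?_ ?_ ?_ ?_ ?_ <;> simp [globalOne]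
  comp₁ i i' i'' _ _ h h' := absurd (h.trans h') (by omega)
  comp₂ _ _ j j' j'' _ _ h h' := absurd (h.trans h') (by omega)

/-- The element of `NG_1` that corresponds to `(m, n)`. -/
def mooreOneOf (x : C.MN) : mooreSubgroup C.binerve.codiagonal 1 :=
  ⟨ofGlobal (isGlobal_one x), mem_moore_iff_glob.2 fun k => by
    obtain rfl : k = 0 := by omega
    intro i i' j j' h₁ h₂ h₃ hi hi' hj hj'
    rw [glob_ofGlobal]
    obtain rfl : i = 1 := Fin.eq_one_of_ne_zero i hi
    obtain rfl : i' = 1 := Fin.eq_one_of_ne_zero i' hi'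
    obtain rfl : j = 1 := Fin.eq_one_of_ne_zero j hj
    obtain rfl : j' = 1 := Fin.eq_one_of_ne_zero j' hj'
    rfl⟩

variable (C) in
/-- The projection of `NG_1` to `M ⋊ N`. -/
def mooreOneHom : mooreSubgroup C.binerve.codiagonal 1 →* C.MN :=
  MonoidHom.mk' (fun x => ⟨(vEdge x).right.left⁻¹, (hEdge x).left.right⁻¹⟩) fun x y => by
    have hv : vEdge (x * y) = vEdge x * vEdge y := rfl
    have hh : hEdge (x * y) = hEdge x * hEdge y := rfl
    rw [hv, hh, vEdge_eq x, vEdge_eq y, hEdge_eq x, hEdge_eq y]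
    generalize (vEdge x).right.left = m, (hEdge x).left.right = n, (vEdge y).right.left = m',
      (hEdge y).left.right = n'
    ext
    -- The Peiffer identity reverses the order of the factors in both coordinates; the inverses in
    -- the definition restore it.
    · change (m * C.actM (C.mu m⁻¹ * C.nu n⁻¹) m')⁻¹ = m⁻¹ * C.actM (C.nu n⁻¹) m'⁻¹
      rw [map_mul, MulAut.mul_apply, C.crossed_mu.peiffer, map_inv (C.actM (C.nu n⁻¹))]
      group
    · change (n * C.actN (C.nu n⁻¹) n')⁻¹ = n⁻¹ * n'⁻¹
      rw [C.crossed_nu.peiffer]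
      group

theorem mooreOneHom_injective : Function.Injective (mooreOneHom C) := by
  refine (injective_iff_map_eq_one _).2 fun x hx => ?_
  have hm : (vEdge x).right.left = 1 := inv_eq_one.1 (congrArg (fun z : C.MN => z.left) hx)
  have hn : (hEdge x).left.right = 1 := inv_eq_one.1 (congrArg (fun z : C.MN => z.right) hx)
  refine eq_one_of_edges ?_ ?_
  · rw [vEdge_eq, hm, hn]; simp
  · rw [hEdge_eq, hn]; simp

theorem vEdge_mooreOneOf (x : C.MN) :
    vEdge (mooreOneOf x) = ⟨1, ⟨x.left⁻¹, C.mu x.left * C.nu x.right⟩⟩ := rfl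

theorem hEdge_mooreOneOf (x : C.MN) :
    hEdge (mooreOneOf x) = ⟨⟨1, x.right⁻¹⟩, ⟨1, C.nu x.right⟩⟩ := rfl

theorem mooreOneHom_mooreOneOf (x : C.MN) : mooreOneHom C (mooreOneOf x) = x := by
  ext
  · exact inv_inv _
  · exact inv_inv _

variable (C) in
/-- `NG_1` is `M ⋊ N`. -/
def mooreOneEquiv : mooreSubgroup C.binerve.codiagonal 1 ≃* C.MN where
  toFun := mooreOneHom C
  invFun := mooreOneOf
  left_inv _ := mooreOneHom_injective (mooreOneHom_mooreOneOf _)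
  right_inv := mooreOneHom_mooreOneOf
  map_mul' := map_mul _

end One

/-! ### Dimension two -/

section Two

/-- The value at `(0, 1, 1, 2)` of an element of `NG_2`. -/
def mooreSquare (x : mooreSubgroup C.binerve.codiagonal 2) : C.Big :=
  glob (A := C.cat2) (n := 2) x.1 0 1 1 2 (by decide) (by decide) (by decide)

/-- The chain meets both `0` and `1`, but horizontal composition expresses its value through `(1, 2,
2, 2)` and `(0, 2, 2, 2)`, which avoid `0` and `1` respectively. -/
theorem glob_last (x : mooreSubgroup C.binerve.codiagonal 2) (h₁ h₂ h₃) :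
    glob (A := C.cat2) (n := 2) x.1 0 1 2 2 h₁ h₂ h₃ = 1 := by
  have := glob_comp₁ (A := C.cat2) (n := 2) x.1 0 1 2 2 2 (by decide) (by decide) (by decide)
    (by decide)
  rw [eq_one_of_mem_moore x 0 1 2 2 2 _ _ _ (by decide) (by decide) (by decide) (by decide),
    eq_one_of_mem_moore x 1 0 2 2 2 _ _ _ (by decide) (by decide) (by decide) (by decide)] at this
  rw [map_one, inv_one, one_mul, one_mul] at this
  exact this.symm

theorem mooreSquare_eq (x : mooreSubgroup C.binerve.codiagonal 2) :
    mooreSquare x = C.square (mooreSquare x).left.left := by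
  refine C.eq_square ?_ ?_
  · exact (t₁_glob (A := C.cat2) (n := 2) x.1 _ _ _ _ _ _ _).trans
      (eq_one_of_mem_moore x 0 _ _ _ _ _ _ _ (by decide) (by decide) (by decide) (by decide))
  · exact (t₂_glob (A := C.cat2) (n := 2) x.1 _ _ _ _ _ _ _).trans (glob_last x _ _ _)

/-- This is the one possibly nontrivial value that is not a source or target of the central square.
It is found from the vertical composite `Y(0, 0, 0, 2)`, trivial since it avoids `1`. -/
theorem glob_first_edge (x : mooreSubgroup C.binerve.codiagonal 2) (h₁ h₂ h₃) :
    glob (A := C.cat2) (n := 2) x.1 0 0 0 1 h₁ h₂ h₃ =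
      C.cat2.s₂ (C.cat2.s₁ (mooreSquare x)) * (C.cat2.s₁ (mooreSquare x))⁻¹ := by
  have := glob_comp₂ (A := C.cat2) (n := 2) x.1 0 0 0 1 2 (by decide) (by decide) (by decide)
    (by decide)
  rw [eq_one_of_mem_moore x 1 0 0 0 2 _ _ _ (by decide) (by decide) (by decide) (by decide)] at this
  have e : glob (A := C.cat2) (n := 2) x.1 0 0 1 2 (by decide) (by decide) (by decide) =
      C.cat2.s₁ (mooreSquare x) := (s₁_glob (A := C.cat2) (n := 2) x.1 _ _ _ _ _ _ _).symm
  rw [e] at this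
  rw [eq_inv_of_mul_eq_one_right this.symm, mul_inv_rev, inv_inv]

theorem eq_one_of_mooreSquare {x : mooreSubgroup C.binerve.codiagonal 2}
    (hx : mooreSquare x = 1) : x = 1 := by
  have e₁ : glob (A := C.cat2) (n := 2) x.1 0 0 0 1 (by decide) (by decide) (by decide) = 1 := by
    rw [glob_first_edge, hx]; simp only [map_one, mul_one, inv_one]
  have e₂ : glob (A := C.cat2) (n := 2) x.1 0 0 1 2 (by decide) (by decide) (by decide) = 1 :=
    (s₁_glob (A := C.cat2) (n := 2) x.1 0 1 1 2 (by decide) (by decide) (by decide)).symm.trans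
      ((congrArg _ hx).trans (map_one _))
  have e₃ : glob (A := C.cat2) (n := 2) x.1 0 1 1 1 (by decide) (by decide) (by decide) = 1 :=
    (s₂_glob (A := C.cat2) (n := 2) x.1 0 1 1 2 (by decide) (by decide) (by decide)).symm.trans
      ((congrArg _ hx).trans (map_one _))
  have e₄ : glob (A := C.cat2) (n := 2) x.1 0 0 1 1 (by decide) (by decide) (by decide) = 1 :=
    (s₂_glob (A := C.cat2) (n := 2) x.1 0 0 1 2 (by decide) (by decide) (by decide)).symm.trans
      ((congrArg _ e₂).trans (map_one _))
  refine Subtype.ext (codiag_ext (A := C.cat2) (n := 2) ?_)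
  intro i i' j j' h₁ h₂ h₃
  refine forall_chain_three (Q := fun i i' j j' => ∀ h₁ h₂ h₃,
    glob (A := C.cat2) (n := 2) x.1 i i' j j' h₁ h₂ h₃ = 1) ?_ (fun _ _ _ => e₁) ?_
    (fun _ _ _ => e₄) (fun _ _ _ => e₂) ?_ (fun _ _ _ => e₃) (fun _ _ _ => hx)
    (fun _ _ _ => glob_last x _ _ _) ?_ ?_ ?_ ?_ ?_ ?_ i i' j j' h₁ h₂ h₃ h₁ h₂ h₃
  all_goals intro h₁ h₂ h₃
  -- Each of the nine remaining chains avoids `0` or `1`.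
  all_goals first
    | exact eq_one_of_mem_moore x 0 _ _ _ _ h₁ h₂ h₃ (by decide) (by decide) (by decide)
        (by decide)
    | exact eq_one_of_mem_moore x 1 _ _ _ _ h₁ h₂ h₃ (by decide) (by decide) (by decide)
        (by decide)

variable (C) in
/-- The values of the element of `NG_2` that corresponds to `l`. -/
def globalTwo (l : L) : Fin 3 → Fin 3 → Fin 3 → Fin 3 → C.Big := fun i i' j j' =>
  match i, i', j, j' with
  | 0, 0, 0, 1 => ⟨1, ⟨C.lam l, 1⟩⟩
  | 0, 0, 1, 1 => ⟨1, ⟨1, C.mu (C.lam l)⟩⟩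
  | 0, 0, 1, 2 => ⟨1, ⟨(C.lam l)⁻¹, C.mu (C.lam l)⟩⟩
  | 0, 1, 1, 1 => ⟨⟨1, (C.lam' l)⁻¹⟩, ⟨1, C.mu (C.lam l)⟩⟩
  | 0, 1, 1, 2 => C.square l
  | _, _, _, _ => 1

theorem isGlobal_two (l : L) : C.cat2.IsGlobal (n := 2) (C.globalTwo l) where
  source₁ := by
    refine forall_chain_three ?_ ?_ ?_ ?_ ?_ ?_ ?_ ?_ ?_ ?_ ?_ ?_ ?_ ?_ ?_ <;>
      simp [globalTwo, square]
  target₁ := by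
    refine forall_chain_three ?_ ?_ ?_ ?_ ?_ ?_ ?_ ?_ ?_ ?_ ?_ ?_ ?_ ?_ ?_
    -- The eighth chain in the enumeration is `(0, 1, 1, 2)`, where the value is the square.
    case refine_8 => exact C.t₁_square l
    all_goals simp [globalTwo, bdLN, nu_lam']
  source₂ := by
    refine forall_chain_three ?_ ?_ ?_ ?_ ?_ ?_ ?_ ?_ ?_ ?_ ?_ ?_ ?_ ?_ ?_ <;>
      simp [globalTwo, square]
  target₂ := by
    refine forall_chain_three ?_ ?_ ?_ ?_ ?_ ?_ ?_ ?_ ?_ ?_ ?_ ?_ ?_ ?_ ?_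
    case refine_8 => exact C.t₂_square l
    all_goals simp [globalTwo]
  comp₁ i i' i'' j j' h h' hj hj' := by
    obtain rfl : i = 0 := Fin.ext (by change (i : ℕ) = 0; omega)
    obtain rfl : i' = 1 := Fin.ext (by change (i' : ℕ) = 1; omega)
    obtain rfl : i'' = 2 := Fin.ext (by change (i'' : ℕ) = 2; omega)
    obtain rfl : j = 2 := Fin.ext (by change (j : ℕ) = 2; omega)
    obtain rfl : j' = 2 := Fin.ext (by change (j' : ℕ) = 2; omega)
    simp [globalTwo]
  comp₂ i i' j j' j'' hi hj h h' := by
    obtain rfl : j = 0 := Fin.ext (by change (j : ℕ) = 0; omega)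
    obtain rfl : j' = 1 := Fin.ext (by change (j' : ℕ) = 1; omega)
    obtain rfl : j'' = 2 := Fin.ext (by change (j'' : ℕ) = 2; omega)
    obtain rfl : i' = 0 := Fin.ext (by change (i' : ℕ) = 0; omega)
    obtain rfl : i = 0 := Fin.ext (by change (i : ℕ) = 0; omega)
    -- The only strict triple is `0 < 1 < 2`; its composition law is what dictates the value
    -- `lam(l)` at `(0, 0, 0, 1)`.
    change (1 : C.Big) = ⟨1, ⟨(C.lam l)⁻¹, C.mu (C.lam l)⟩⟩ *
      (⟨1, ⟨1, C.mu (C.lam l)⟩⟩ : C.Big)⁻¹ * ⟨1, ⟨C.lam l, 1⟩⟩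
    ext <;> simp

/-- The element of `NG_2` that corresponds to `l`. -/
def mooreTwoOf (l : L) : mooreSubgroup C.binerve.codiagonal 2 :=
  ⟨ofGlobal (isGlobal_two l), mem_moore_iff_glob.2 fun k => by
    intro i i' j j' h₁ h₂ h₃
    rw [glob_ofGlobal]
    revert k
    refine forall_chain_three (Q := fun i i' j j' => ∀ k : Fin 2, i ≠ k.castSucc →
      i' ≠ k.castSucc → j ≠ k.castSucc → j' ≠ k.castSucc → C.globalTwo l i i' j j' = 1)
      ?_ ?_ ?_ ?_ ?_ ?_ ?_ ?_ ?_ ?_ ?_ ?_ ?_ ?_ ?_ i i' j j' h₁ h₂ h₃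
    -- Where the prescribed value is not `1` by definition, the chain starts at `0` and has `j = 1`
    -- or `j' = 1`, so it avoids neither `0` nor `1`.
    all_goals first
      | exact fun _ _ _ _ _ => rfl
      | exact Fin.forall_fin_two.2 ⟨fun h => absurd rfl h, fun _ h h' => absurd rfl h'⟩
      | exact Fin.forall_fin_two.2 ⟨fun h => absurd rfl h, fun _ _ _ h => absurd rfl h⟩⟩

variable (C) in
/-- The projection of `NG_2` to `L`. -/
def mooreTwoHom : mooreSubgroup C.binerve.codiagonal 2 →* L :=
  MonoidHom.mk' (fun x => (mooreSquare x).left.left) fun x y => by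
    have h : mooreSquare (x * y) = mooreSquare x * mooreSquare y := rfl
    rw [h, mooreSquare_eq x, mooreSquare_eq y, square_mul]
    rfl

theorem mooreTwoHom_injective : Function.Injective (mooreTwoHom C) := by
  refine (injective_iff_map_eq_one _).2 fun x hx => eq_one_of_mooreSquare ?_
  have hl : (mooreSquare x).left.left = 1 := hx
  rw [mooreSquare_eq, hl, square]
  simp

theorem mooreTwoHom_mooreTwoOf (l : L) : mooreTwoHom C (mooreTwoOf l) = l := rfl

variable (C) in
/-- `NG_2` is `L`. -/
def mooreTwoEquiv : mooreSubgroup C.binerve.codiagonal 2 ≃* L where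
  toFun := mooreTwoHom C
  invFun := mooreTwoOf
  left_inv _ := mooreTwoHom_injective (mooreTwoHom_mooreTwoOf _)
  right_inv := mooreTwoHom_mooreTwoOf
  map_mul' := map_mul _

end Two

end CrossedSquare

/-! ### Differentials, actions and Peiffer pairing under the isomorphism -/

namespace CrossedSquare

open scoped Simplicial
open SimplicialGroup Cat2Group

variable {L M N P : Type u} [Group L] [Group M] [Group N] [Group P] {C : CrossedSquare L M N P}

/-- Deleting vertex `1` leaves `Y(0, 0, 0, 0)`, the vertical source of the vertical edge. -/
theorem mooreZeroEquiv_mooreD (x : mooreSubgroup C.binerve.codiagonal 1) :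
    mooreZeroEquiv C (mooreD C.binerve.codiagonal 0 x) = C.coneD₁ (mooreOneEquiv C x) := by
  have h : vertex (mooreD C.binerve.codiagonal 0 x) = C.cat2.s₂ (vEdge x) :=
    (glob_face (A := C.cat2) (n := 0) 1 x.1 0 0 0 0 _ _ _).trans
      (s₂_glob (A := C.cat2) (n := 1) x.1 0 0 0 1 _ _ _).symm
  change (vertex _).right.right = C.mu (vEdge x).right.left⁻¹ * C.nu (hEdge x).left.right⁻¹
  rw [h]
  exact congrArg (fun z : C.Big => z.right.right) (vEdge_eq x)

/-- Deleting vertex `2` leaves `Y(0, 0, 0, 1)`, known from `glob_first_edge`, and `Y(0, 1, 1, 1)`,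
the vertical source of the square. -/
theorem mooreOneEquiv_mooreD (x : mooreSubgroup C.binerve.codiagonal 2) :
    mooreOneEquiv C (mooreD C.binerve.codiagonal 1 x) = C.coneD₂ (mooreTwoEquiv C x) := by
  have hv : vEdge (mooreD C.binerve.codiagonal 1 x) =
      C.cat2.s₂ (C.cat2.s₁ (mooreSquare x)) * (C.cat2.s₁ (mooreSquare x))⁻¹ :=
    (glob_face (A := C.cat2) (n := 1) 2 x.1 0 0 0 1 _ _ _).trans (glob_first_edge x _ _ _)
  have hh : hEdge (mooreD C.binerve.codiagonal 1 x) = C.cat2.s₂ (mooreSquare x) :=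
    (glob_face (A := C.cat2) (n := 1) 2 x.1 0 1 1 1 _ _ _).trans
      (s₂_glob (A := C.cat2) (n := 2) x.1 0 1 1 2 _ _ _).symm
  change (⟨(vEdge _).right.left⁻¹, (hEdge _).left.right⁻¹⟩ : C.MN) =
    C.coneD₂ (mooreSquare x).left.left
  rw [hv, hh, mooreSquare_eq]
  generalize (mooreSquare x).left.left = l
  ext
  · simp [square, coneD₂]
  · simp [square, coneD₂]

theorem moore_eq_one {n : ℕ} (hn : 3 ≤ n) (x : mooreSubgroup C.binerve.codiagonal n) : x = 1 :=
  Subtype.ext ((Subgroup.eq_bot_iff_forall _).1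
    (mooreSubgroup_codiagonal_eq_bot (A := C.cat2) n hn) x.1 x.2)

theorem mooreTwoEquiv_mooreD (x : mooreSubgroup C.binerve.codiagonal 3) :
    mooreTwoEquiv C (mooreD C.binerve.codiagonal 2 x) = 1 := by
  have h : x = 1 := moore_eq_one le_rfl x
  rw [h, map_one (mooreD C.binerve.codiagonal 2), map_one]

variable (C) in
/-- The isomorphism between the Moore complex and the mapping cone in each dimension. -/
def mooreEquiv : ∀ n, mooreSubgroup C.binerve.codiagonal n ≃* C.coneX n := fun n =>
  match n with
  | 0 => mooreZeroEquiv C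
  | 1 => mooreOneEquiv C
  | 2 => mooreTwoEquiv C
  | n + 3 =>
    { toFun := fun _ => PUnit.unit
      invFun := fun _ => 1
      left_inv := fun x => (moore_eq_one (Nat.le_add_left 3 n) x).symm
      right_inv := fun _ => rfl
      map_mul' := fun _ _ => rfl }

theorem mooreEquiv_mooreD : ∀ (n : ℕ) (x : mooreSubgroup C.binerve.codiagonal (n + 1)),
    mooreEquiv C n (mooreD C.binerve.codiagonal n x) = C.coneD n (mooreEquiv C (n + 1) x) := fun n =>
  match n with
  | 0 => mooreZeroEquiv_mooreD
  | 1 => mooreOneEquiv_mooreD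
  | 2 => mooreTwoEquiv_mooreD
  | _ + 3 => fun _ => rfl

variable (C) in
/-- The isomorphism between the Moore complex of the codiagonal and the mapping cone. -/
def mooreIso : NormalChainComplex.Iso C.NG C.mappingCone where
  equiv := mooreEquiv C
  comm := mooreEquiv_mooreD

theorem mooreOneEquiv_mooreAct₁ (p : mooreSubgroup C.binerve.codiagonal 0)
    (x : mooreSubgroup C.binerve.codiagonal 1) :
    mooreOneEquiv C (mooreAct₁ p x) = C.actMN (mooreZeroEquiv C p) (mooreOneEquiv C x) := by
  -- A degenerate vertex takes the same value on every chain, so the action conjugates each value by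
  -- it.
  have hv : vEdge (mooreAct₁ p x) = vertex p * vEdge x * (vertex p)⁻¹ := rfl
  have hh : hEdge (mooreAct₁ p x) = vertex p * hEdge x * (vertex p)⁻¹ := rfl
  change (⟨(vEdge _).right.left⁻¹, (hEdge _).left.right⁻¹⟩ : C.MN) =
    C.actMN (vertex p).right.right ⟨(vEdge x).right.left⁻¹, (hEdge x).left.right⁻¹⟩
  rw [hv, hh, vertex_eq]
  generalize (vertex p).right.right = q, vEdge x = v, hEdge x = w
  have e : (⟨1, ⟨1, q⟩⟩ : C.Big)⁻¹ = ⟨1, ⟨1, q⁻¹⟩⟩ := by ext <;> simp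
  rw [e]
  ext
  · simp
  · simp [actLN_apply]

theorem mooreTwoEquiv_mooreAct₂ (p : mooreSubgroup C.binerve.codiagonal 0)
    (x : mooreSubgroup C.binerve.codiagonal 2) :
    mooreTwoEquiv C (mooreAct₂ p x) = C.actL (mooreZeroEquiv C p) (mooreTwoEquiv C x) := by
  have h : mooreSquare (mooreAct₂ p x) = vertex p * mooreSquare x * (vertex p)⁻¹ := rfl
  change (mooreSquare _).left.left = C.actL (vertex p).right.right (mooreSquare x).left.left
  rw [h, vertex_eq]
  generalize (vertex p).right.right = q, mooreSquare x = v
  have e : (⟨1, ⟨1, q⟩⟩ : C.Big)⁻¹ = ⟨1, ⟨1, q⁻¹⟩⟩ := by ext <;> simp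
  rw [e]
  simp [actLN_apply, h_one_left, h_one_right]

/-- The square on `h(m, a)` is the commutator of an `M`-edge and an `N`-edge. Moving the inverses to
the other side keeps the coordinate computation short. -/
theorem square_h_mul (m : M) (a : N) :
    C.square (C.h m a) * ((⟨⟨1, a⁻¹⟩, ⟨1, C.nu a⟩⟩ : C.Big) * ⟨1, ⟨m⁻¹, C.mu m⟩⟩) =
      (⟨1, ⟨m⁻¹, C.mu m⟩⟩ : C.Big) * ⟨⟨1, a⁻¹⟩, ⟨1, C.nu a⟩⟩ := by
  have e₁ : (⟨⟨1, a⁻¹⟩, ⟨1, C.nu a⟩⟩ : C.Big) * ⟨1, ⟨m⁻¹, C.mu m⟩⟩ =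
      ⟨⟨1, a⁻¹⟩, ⟨C.actM (C.nu a) m⁻¹, C.nu a * C.mu m⟩⟩ := by
    ext <;> simp
  have e₂ : (⟨1, ⟨m⁻¹, C.mu m⟩⟩ : C.Big) * ⟨⟨1, a⁻¹⟩, ⟨1, C.nu a⟩⟩ =
      ⟨⟨C.h m⁻¹ (C.actN (C.mu m) a⁻¹), C.actN (C.mu m) a⁻¹⟩, ⟨m⁻¹, C.mu m * C.nu a⟩⟩ := by
    ext
    · change 1 * C.actL (C.nu 1) (C.actL (C.mu m⁻¹ * C.mu m) 1 * C.h m⁻¹ (C.actN (C.mu m) a⁻¹)) = _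
      simp only [map_one, one_mul, MulAut.one_apply]
    · exact one_mul _
    · change m⁻¹ * C.actM (C.mu m) 1 = _
      rw [map_one, mul_one]
    · rfl
  have e₃ : C.actM (C.mu m) m⁻¹ = m⁻¹ := by rw [C.crossed_mu.peiffer]; group
  rw [e₁, e₂]
  generalize hl : C.h m a = l
  have hlam : C.lam l = m * C.actM (C.nu a) m⁻¹ := by rw [← hl, lam_h]
  have hlam' : C.lam' l = C.actN (C.mu m) a * a⁻¹ := by rw [← hl, lam'_h]
  ext
  · change l * C.actL (C.nu (C.lam' l)⁻¹) (C.actL (C.mu (C.lam l)⁻¹ * C.mu (C.lam l)) 1 *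
      C.h (C.lam l)⁻¹ (C.actN (C.mu (C.lam l)) a⁻¹)) = C.h m⁻¹ (C.actN (C.mu m) a⁻¹)
    have hr : C.h m⁻¹ (C.actN (C.mu m) a⁻¹) = C.actL (C.nu a⁻¹) l := by
      rw [← e₃, h_equivariant, h_inv_left, h_inv_right, hl, map_inv, inv_inv, ← map_inv C.nu]
    rw [hr, ← nu_lam', C.crossed_nu.peiffer, h_inv_lam, actL_nu_conj_lam', ← map_inv C.lam',
      nu_lam', act_kappa]
    rw [inv_mul_cancel, one_mul, map_one]
    group
  · change (C.lam' l)⁻¹ * C.actN (C.mu (C.lam l)) a⁻¹ = C.actN (C.mu m) a⁻¹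
    rw [← nu_lam', C.crossed_nu.peiffer, hlam', map_inv]
    group
  · change (C.lam l)⁻¹ * C.actM (C.mu (C.lam l)) (C.actM (C.nu a) m⁻¹) = m⁻¹
    rw [C.crossed_mu.peiffer, hlam]
    group
  · change C.mu (C.lam l) * (C.nu a * C.mu m) = C.mu m * C.nu a
    rw [hlam, map_mul, mu_act, map_inv]
    group

theorem mooreTwoEquiv_peiffer (x y : mooreSubgroup C.binerve.codiagonal 1) :
    mooreTwoEquiv C (peiffer x y) =
      C.coneTwoCrossedModule.lift (mooreOneEquiv C x) (mooreOneEquiv C y) := by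
  obtain ⟨⟨m, n⟩, rfl⟩ := (mooreOneEquiv C).symm.surjective x
  obtain ⟨⟨m', n'⟩, rfl⟩ := (mooreOneEquiv C).symm.surjective y
  simp only [MulEquiv.apply_symm_apply]
  change (mooreSquare (peiffer (mooreOneOf ⟨m, n⟩) (mooreOneOf ⟨m', n'⟩))).left.left =
    C.h m (n * n' * n⁻¹)
  set x : mooreSubgroup C.binerve.codiagonal 1 := mooreOneOf ⟨m, n⟩
  set y : mooreSubgroup C.binerve.codiagonal 1 := mooreOneOf ⟨m', n'⟩
  -- On the chain `(0, 1, 1, 2)`, `s_0` reads the value at `(0, 0, 0, 1)` and `s_1` the one at `(0,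
  -- 1, 1, 1)`.
  have h : mooreSquare (peiffer x y) =
    vEdge x * hEdge y * (vEdge x)⁻¹ * hEdge (x * y⁻¹ * x⁻¹) := rfl
  set a := n * n' * n⁻¹
  have e₁ : hEdge (x * y⁻¹ * x⁻¹) = (⟨⟨1, a⁻¹⟩, ⟨1, C.nu a⟩⟩ : C.Big)⁻¹ := by
    have e : x * y⁻¹ * x⁻¹ = (x * y * x⁻¹)⁻¹ := by group
    have e' : (⟨m, n⟩ * ⟨m', n'⟩ * ⟨m, n⟩⁻¹ : C.MN).right = a := rfl
    have e'' : x * y * x⁻¹ = mooreOneOf (⟨m, n⟩ * ⟨m', n'⟩ * ⟨m, n⟩⁻¹ : C.MN) := by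
      refine mooreOneHom_injective ?_
      simp only [map_mul, map_inv, x, y, mooreOneHom_mooreOneOf]
    have hi : ∀ z : mooreSubgroup C.binerve.codiagonal 1, hEdge z⁻¹ = (hEdge z)⁻¹ := fun _ => rfl
    rw [e, e'', hi, hEdge_mooreOneOf, e']
  have e₂ : vEdge x = (⟨1, ⟨m⁻¹, C.mu m⟩⟩ : C.Big) * ⟨1, ⟨1, C.nu n⟩⟩ := by
    rw [vEdge_mooreOneOf]
    ext <;> simp
  -- Moving the factor `nu(n)` of `vEdge x` past `hEdge y` conjugates `n'` to `a`; what remains is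
  -- the commutator of `square_h_mul`.
  have e₃ : (⟨1, ⟨1, C.nu n⟩⟩ : C.Big) * hEdge y =
      (⟨⟨1, a⁻¹⟩, ⟨1, C.nu a⟩⟩ : C.Big) * ⟨1, ⟨1, C.nu n⟩⟩ := by
    rw [hEdge_mooreOneOf]
    ext <;> simp [a, actLN_apply, h_one_left, C.crossed_nu.peiffer, mul_assoc]
  rw [h, e₁, e₂]
  have key : (⟨1, ⟨m⁻¹, C.mu m⟩⟩ : C.Big) * ⟨1, ⟨1, C.nu n⟩⟩ * hEdge y *
      ((⟨1, ⟨m⁻¹, C.mu m⟩⟩ : C.Big) * ⟨1, ⟨1, C.nu n⟩⟩)⁻¹ *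
      (⟨⟨1, a⁻¹⟩, ⟨1, C.nu a⟩⟩ : C.Big)⁻¹ = C.square (C.h m a) := by
    rw [mul_inv_eq_iff_eq_mul, mul_inv_eq_iff_eq_mul, mul_assoc, e₃, ← mul_assoc,
      ← square_h_mul]
    simp only [mul_assoc]
  rw [key]
  rfl

end CrossedSquare

theorem mainTheorem2 {L M N P : Type u} [Group L] [Group M] [Group N] [Group P]
    (C : CrossedSquare L M N P) :
    (∀ n, 3 ≤ n → SimplicialGroup.mooreSubgroup C.binerve.codiagonal n = ⊥) ∧
    ∃ e : NormalChainComplex.Iso C.NG C.mappingCone,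
      ((∀ p : P,
          CrossedSquare.coord ((e.equiv 0).symm p) 0 0 rfl 0 0 le_rfl 0 0 le_rfl =
            ⟨1, ⟨1, p⟩⟩) ∧
        (∀ (m : M) (n : N),
          CrossedSquare.coord ((e.equiv 1).symm (⟨m, n⟩ : C.MN)) 0 1 rfl
              0 0 le_rfl 0 1 (Fin.zero_le _) = ⟨1, ⟨m⁻¹, C.mu m * C.nu n⟩⟩ ∧
          CrossedSquare.coord ((e.equiv 1).symm (⟨m, n⟩ : C.MN)) 1 0 rfl
              0 1 (Fin.zero_le _) 0 0 le_rfl = ⟨⟨1, n⁻¹⟩, ⟨1, C.nu n⟩⟩) ∧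
        (∀ l : L,
          CrossedSquare.coord ((e.equiv 2).symm l) 0 2 rfl
              0 0 le_rfl 0 1 (by decide) = ⟨1, ⟨C.lam l, 1⟩⟩ ∧
          CrossedSquare.coord ((e.equiv 2).symm l) 0 2 rfl
              0 0 le_rfl 1 2 (by decide) = ⟨1, ⟨(C.lam l)⁻¹, C.mu (C.lam l)⟩⟩ ∧
          CrossedSquare.coord ((e.equiv 2).symm l) 1 1 rfl
              0 1 (Fin.zero_le _) 0 1 (Fin.zero_le _) =
            ⟨⟨l, (C.lam' l)⁻¹⟩, ⟨(C.lam l)⁻¹, C.mu (C.lam l)⟩⟩ ∧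
          ∀ (i i' : Fin 3) (hi : i ≤ i'),
            CrossedSquare.coord ((e.equiv 2).symm l) 2 0 rfl i i' hi 0 0 le_rfl = 1)) ∧
      ∃ T : TwoCrossedModule L C.MN P,
        T.d₂ = C.coneD₂ ∧
        T.d₁ = C.coneD₁ ∧
        (∀ p x, e.equiv 1 (SimplicialGroup.mooreAct₁ p x) =
          T.actM (e.equiv 0 p) (e.equiv 1 x)) ∧
        (∀ p y, e.equiv 2 (SimplicialGroup.mooreAct₂ p y) =
          T.actL (e.equiv 0 p) (e.equiv 2 y)) ∧
        (∀ x y, e.equiv 2 (SimplicialGroup.peiffer x y) =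
          T.lift (e.equiv 1 x) (e.equiv 1 y)) := by
  refine ⟨Cat2Group.mooreSubgroup_codiagonal_eq_bot (A := C.cat2), C.mooreIso,
    ⟨fun p => ?_, fun m n => ⟨?_, ?_⟩, fun l => ⟨?_, ?_, ?_, fun i i' hi => ?_⟩⟩,
    C.coneTwoCrossedModule, rfl, rfl, CrossedSquare.mooreOneEquiv_mooreAct₁,
    CrossedSquare.mooreTwoEquiv_mooreAct₂, CrossedSquare.mooreTwoEquiv_peiffer⟩
  · rfl
  · rfl
  · rfl
  · rfl
  · rfl
  · rfl
  · revert hi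
    fin_cases i <;> fin_cases i' <;> exact fun _ => rfl
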